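/- Let $n\ge 3$ and give the edges of the complete directed graph on $n$ vertices (respectively, of the complete undirected graph on $n$ vertices) independent weights, exponentially distributed with mean $1$. Cycles are simple: directed cycles have length $k\ge 2$, undirected cycles have length $k\ge 3$. The mean weight of a cycle $C$ of length $k$ is $w(C)/k$, where $w(C)$ is the sum of the weights of its edges, and $C$ is called $c$-light if its mean weight is at most $c/n$. Put $L_0=L_0(n)=\log n/(2\log\log n)$. Fix a real number $c_0$. Regard the collection of $c_0$-light cycles of length at most $L_0$ as a point process $\xi_n$ on $\{\text{cycles}\}\times(-\infty,c_0]$, having one point $(C,\;n\,w(C)/|C|)$ for every $c_0$-light cycle $C$ of length $|C|\le L_0$, and let $\Lambda_n(B)=\mathbb E[\xi_n(B)]$ be its intensity, the expected number of such cycles with $(C,\;n\,w(C)/|C|)\in B$. Then, both for the directed and for the undirected complete graphs, for every $\varepsilon>0$ and all sufficiently large $n$: 1. the total variation distance between the law of $\xi_n$ and the law of the Poisson process with intensity measure $\Lambda_n$ is at most $\varepsilon$; 2. in particular, the edge weights and a Poisson process $\eta_n$ with intensity measure $\Lambda_n$ can be defined on a common probability space in such a way that, except with probability at most $\varepsilon$,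 simultaneously for all integers $k\le L_0$ and all real $c\le c_0$, the number of $c$-light cycles of length $k$ equals the number $\eta_n(\{C:|C|=k\}\times(-\infty,c])$ of points of the Poisson process in the corresponding region. -/

import Mathlib

open MeasureTheory ProbabilityTheory Filter
open scoped ENNReal

/-! ### Cycles of the complete graphs -/

/-- The edges of the complete directed graph on `V` (no loops). -/
abbrev DirEdge (V : Type*) : Type _ := {e : V × V // e.1 ≠ e.2}

/-- The edges of the complete undirected graph on `V` (no loops). -/
abbrev UndirEdge (V : Type*) : Type _ := {e : Sym2 V // ¬ e.IsDiag}

/-- The directed cycles of the complete directed graph on `V`, as edge sets: for some `k ≥ 2` and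
some sequence `v 0, …, v (k - 1)` of distinct vertices, the edges are `v 0 → v 1 → ⋯ → v 0`. -/
def dirCycles (V : Type*) : Set (Finset (DirEdge V)) :=
  {C | ∃ k : ℕ, 2 ≤ k ∧ ∃ v : ZMod k → V, Function.Injective v ∧
    Subtype.val '' (C : Set (DirEdge V)) = Set.range fun i : ZMod k => (v i, v (i + 1))}

/-- The undirected cycles of the complete undirected graph on `V`, as edge sets: for some `k ≥ 3`
and some sequence `v 0, …, v (k - 1)` of distinct vertices, the edges are
`{v 0, v 1}, {v 1, v 2}, …, {v (k - 1), v 0}`. -/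
def undirCycles (V : Type*) : Set (Finset (UndirEdge V)) :=
  {C | ∃ k : ℕ, 3 ≤ k ∧ ∃ v : ZMod k → V, Function.Injective v ∧
    Subtype.val '' (C : Set (UndirEdge V)) = Set.range fun i : ZMod k => s(v i, v (i + 1))}

/-! ### Light cycles

Below, `E` is the set of edges, a cycle is a finite set of edges (so that its length is its
cardinality), `𝒞` is the set of all cycles, `w` gives the edge weights and `n` is the number of
vertices. -/

/-- The mean weight of a cycle. -/
noncomputable def meanWeight {E : Type*} (w : E → ℝ) (C : Finset E) : ℝ :=
  (∑ e ∈ C, w e) / (C.card : ℝ)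

/-- A cycle is `c`-light if its mean weight is at most `c / n`. -/
def IsLight {E : Type*} (n : ℕ) (w : E → ℝ) (c : ℝ) (C : Finset E) : Prop :=
  meanWeight w C ≤ c / (n : ℝ)

/-- The length bound `L₀ = log n / (2 log log n)`. -/
noncomputable def shortLength (n : ℕ) : ℝ :=
  Real.log (n : ℝ) / (2 * Real.log (Real.log (n : ℝ)))

open Classical in
/-- The collection of the `c₀`-light cycles `C` of length at most `L₀`, each recorded together with
the level at which it becomes light: the point configuration (counting measure) having one point
`(C, n * meanWeight w C)` for every such cycle. -/
noncomputable def lightCycles {E : Type*} [Fintype E] (𝒞 : Set (Finset E)) (n : ℕ) (c₀ : ℝ)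
    (w : E → ℝ) : Measure (Finset E × ℝ) :=
  ∑ C : Finset E with C ∈ 𝒞 ∧ (C.card : ℝ) ≤ shortLength n ∧ IsLight n w c₀ C,
    Measure.dirac (C, (n : ℝ) * meanWeight w C)

/-- The joint law of i.i.d. exponential edge weights of mean `1`. -/
noncomputable def weightLaw (E : Type*) [Fintype E] : Measure (E → ℝ) :=
  Measure.pi fun _ => expMeasure 1

/-- The intensity: the expected number of short `c₀`-light cycles that fall into a given set. -/
noncomputable def lightIntensity {E : Type*} [Fintype E] (𝒞 : Set (Finset E)) (n : ℕ) (c₀ : ℝ) :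
    Measure (Finset E × ℝ) :=
  (weightLaw E).bind (lightCycles 𝒞 n c₀)

theorem measurable_meanWeight {E : Type*} (C : Finset E) :
    Measurable fun w : E → ℝ => meanWeight w C := by
  unfold meanWeight
  fun_prop

theorem measurable_lightCycles {E : Type*} [Fintype E] (𝒞 : Set (Finset E)) (n : ℕ) (c₀ : ℝ) :
    Measurable (lightCycles 𝒞 n c₀) := by
  classical
  refine Measure.measurable_of_measurable_coe _ fun B hB => ?_
  have h : ∀ w : E → ℝ, lightCycles 𝒞 n c₀ w B = ∑ C : Finset E,
      if C ∈ 𝒞 ∧ (C.card : ℝ) ≤ shortLength n ∧ IsLight n w c₀ C then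
        B.indicator (1 : Finset E × ℝ → ℝ≥0∞) (C, (n : ℝ) * meanWeight w C) else 0 := by
    intro w
    rw [lightCycles, Measure.coe_finsetSum, Finset.sum_apply, Finset.sum_filter]
    refine Finset.sum_congr rfl fun C _ => ?_
    rw [Measure.dirac_apply' _ hB]
  simp only [h]
  refine Finset.measurable_sum _ fun C _ => Measurable.ite ?_ ?_ measurable_const
  · exact (MeasurableSet.const (C ∈ 𝒞)).inter ((MeasurableSet.const _).inter
      (measurableSet_le (measurable_meanWeight C) measurable_const))
  · exact (measurable_one.indicator hB).comp
      (measurable_const.prodMk ((measurable_meanWeight C).const_mul (n : ℝ)))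

/-- The intensity of a set `B` is the expected number of short `c₀`-light cycles in `B`. -/
theorem lightIntensity_apply {E : Type*} [Fintype E] (𝒞 : Set (Finset E)) (n : ℕ) (c₀ : ℝ)
    {B : Set (Finset E × ℝ)} (hB : MeasurableSet B) :
    lightIntensity 𝒞 n c₀ B = ∫⁻ w, lightCycles 𝒞 n c₀ w B ∂(weightLaw E) :=
  Measure.bind_apply hB (measurable_lightCycles 𝒞 n c₀).aemeasurable

/-! ### Poisson processes and total variation -/

/-- `Q`, a probability measure on the space of measures on `X`, is the law of a Poisson process
with (σ-finite) intensity `Λ`: the number of points in a set of finite intensity has the Poisson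
distribution with that mean, and the numbers of points in finitely many disjoint sets are
independent. -/
structure IsPoissonProcessLaw {X : Type*} [MeasurableSpace X] (Λ : Measure X)
    (Q : Measure (Measure X)) : Prop where
  isProbabilityMeasure : IsProbabilityMeasure Q
  count_law : ∀ B : Set X, MeasurableSet B → Λ B ≠ ∞ →
    Q.map (fun ν => ν B) = (poissonMeasure (Λ B).toNNReal).map (fun k : ℕ => (k : ℝ≥0∞))
  indep : ∀ (m : ℕ) (B : Fin m → Set X), (∀ i, MeasurableSet (B i)) →
    Pairwise (Function.onFun Disjoint B) → iIndepFun (fun i (ν : Measure X) => ν (B i)) Q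

/-- Total variation distance of two probability measures: the largest difference of the
probabilities that they give to an event. -/
noncomputable def tvDist {X : Type*} [MeasurableSpace X] (μ ν : Measure X) : ℝ :=
  ⨆ A : {A : Set X // MeasurableSet A}, |μ.real A - ν.real A|

/-!
The light cycles are a sum of `0`-or-`1`-point processes, one for each short cycle, and each of
these is independent of those of the cycles that share no edge with it. Replacing these point
processes one after the other by independent Poisson processes with the same intensities costs, in
total variation, the probability that the given cycle and an overlapping one are both light. A
Poisson process of finite intensity is a convergent series of convolution powers, and it is
identified by the characteristic functions of its counts.

Two distinct overlapping cycles span at least one more edge than they have vertices: every vertex is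
the start of an edge of the union, and where they part there are two. A union of `m` edges is light
with probability of order `n⁻ᵐ`, while there are at most `nᵛ` ways to place `v` vertices, so
overlaps cost a factor `1 / n`. The combinatorial factor `(L + 1) ^ (L + 2)` is at most `√n` up to
powers of `log n` for `L ≤ log n / (2 log log n)`: this is the reason for the bound `L₀`.

Finally, two laws within distance `ε` share a common part of mass `1 - ε`. Coupling the weights with
the Poisson process so that they agree on it matches the counts for all `k` and `c` at once, as
these are read off from the point configuration.
-/

/-! ### Poisson processes of finite intensity -/

section CountChar

variable {X : Type*} [MeasurableSpace X] {ι : Type*} [Fintype ι]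

/-- The character `ν ↦ exp (i ∑ⱼ tⱼ ν(Bⱼ))` on the space of measures. Its integrals form the
characteristic functional of a random measure. -/
noncomputable def countChar (t : ι → ℝ) (B : ι → Set X) (ν : Measure X) : ℂ :=
  Complex.exp ((∑ i, t i * ν.real (B i) : ℝ) * Complex.I)

theorem measurable_measureReal {B : Set X} (hB : MeasurableSet B) :
    Measurable fun ν : Measure X => ν.real B :=
  (Measure.measurable_coe hB).ennreal_toReal

theorem measurable_countChar (t : ι → ℝ) {B : ι → Set X} (hB : ∀ i, MeasurableSet (B i)) :
    Measurable (countChar t B) := by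
  have : Measurable fun ν : Measure X => (∑ i, t i * ν.real (B i) : ℝ) :=
    Finset.measurable_sum _ fun i _ => (measurable_measureReal (hB i)).const_mul _
  unfold countChar
  fun_prop

theorem norm_countChar (t : ι → ℝ) (B : ι → Set X) (ν : Measure X) : ‖countChar t B ν‖ = 1 :=
  Complex.norm_exp_ofReal_mul_I _

theorem integrable_countChar (t : ι → ℝ) {B : ι → Set X} (hB : ∀ i, MeasurableSet (B i))
    (Q : Measure (Measure X)) [IsFiniteMeasure Q] : Integrable (countChar t B) Q :=
  .of_bound (measurable_countChar t hB).aestronglyMeasurable 1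
    (.of_forall fun ν => (norm_countChar t B ν).le)

theorem integrable_countChar_dirac (t : ι → ℝ) {B : ι → Set X} (hB : ∀ i, MeasurableSet (B i))
    (Λ : Measure X) [IsFiniteMeasure Λ] :
    Integrable (fun x => countChar t B (Measure.dirac x)) Λ :=
  (integrable_countChar t hB (Λ.map Measure.dirac)).comp_measurable Measure.measurable_dirac

theorem countChar_zero (t : ι → ℝ) (B : ι → Set X) : countChar t B 0 = 1 := by
  simp [countChar]

theorem countChar_add (t : ι → ℝ) (B : ι → Set X) (μ ν : Measure X) [IsFiniteMeasure μ]
    [IsFiniteMeasure ν] : countChar t B (μ + ν) = countChar t B μ * countChar t B ν := by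
  have hreal (i : ι) : (μ + ν).real (B i) = μ.real (B i) + ν.real (B i) := measureReal_add_apply
  simp only [countChar, hreal, mul_add, Finset.sum_add_distrib, Complex.ofReal_add, add_mul,
    Complex.exp_add]

theorem dirac_real_apply {B : Set X} (hB : MeasurableSet B) (x : X) :
    (Measure.dirac x).real B = B.indicator 1 x := by
  by_cases hx : x ∈ B <;> simp [measureReal_def, Measure.dirac_apply' _ hB, hx]

theorem countChar_dirac_sub_one (t : ι → ℝ) {B : ι → Set X} (hB : ∀ i, MeasurableSet (B i))
    (hd : Pairwise (Function.onFun Disjoint B)) (x : X) :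
    countChar t B (Measure.dirac x) - 1 =
      ∑ i, (B i).indicator (fun _ => Complex.exp (t i * Complex.I) - 1) x := by
  simp only [countChar, dirac_real_apply (hB _)]
  by_cases hx : ∃ j, x ∈ B j
  · obtain ⟨j, hj⟩ := hx
    have hne : ∀ i, i ≠ j → x ∉ B i := fun i hi h => (hd hi).notMem_of_mem_left h hj
    rw [Finset.sum_eq_single j (fun i _ hi => by simp [hne i hi]) (by simp),
      Finset.sum_eq_single j (fun i _ hi => by simp [hne i hi]) (by simp)]
    simp [hj]
  · push Not at hx
    simp [hx]

theorem integral_countChar_dirac_sub_one (Λ : Measure X) [IsFiniteMeasure Λ] (t : ι → ℝ)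
    {B : ι → Set X} (hB : ∀ i, MeasurableSet (B i)) (hd : Pairwise (Function.onFun Disjoint B)) :
    ∫ x, (countChar t B (Measure.dirac x) - 1) ∂Λ =
      ∑ i, (Λ.real (B i) : ℂ) * (Complex.exp (t i * Complex.I) - 1) := by
  simp only [countChar_dirac_sub_one t hB hd]
  rw [integral_finsetSum _ fun i _ => (integrable_const _).indicator (hB i)]
  refine Finset.sum_congr rfl fun i _ => ?_
  rw [integral_indicator (hB i), setIntegral_const, Complex.real_smul]

end CountChar

section Convolution

variable {X : Type*} [MeasurableSpace X] {Q₁ Q₂ : Measure (Measure X)}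

theorem conv_univ [SFinite Q₂] : (Q₁ ∗ Q₂) Set.univ = Q₁ Set.univ * Q₂ Set.univ := by
  rw [Measure.conv, Measure.map_apply (by fun_prop) .univ, Set.preimage_univ,
    ← Set.univ_prod_univ, Measure.prod_prod]

theorem ae_isFiniteMeasure_conv (h₁ : ∀ᵐ ν ∂Q₁, IsFiniteMeasure ν)
    (h₂ : ∀ᵐ ν ∂Q₂, IsFiniteMeasure ν) : ∀ᵐ ν ∂(Q₁ ∗ Q₂), IsFiniteMeasure ν := by
  rw [Measure.conv, ae_map_iff (by fun_prop) FiniteMeasure.measurableSet_isFiniteMeasure]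
  filter_upwards [Measure.quasiMeasurePreserving_fst.ae h₁,
    Measure.quasiMeasurePreserving_snd.ae h₂] with p _ _
  infer_instance

variable [IsFiniteMeasure Q₁] [IsFiniteMeasure Q₂]

theorem integral_countChar_conv (h₁ : ∀ᵐ ν ∂Q₁, IsFiniteMeasure ν)
    (h₂ : ∀ᵐ ν ∂Q₂, IsFiniteMeasure ν) {ι : Type*} [Fintype ι] (t : ι → ℝ) {B : ι → Set X}
    (hB : ∀ i, MeasurableSet (B i)) :
    ∫ ν, countChar t B ν ∂(Q₁ ∗ Q₂) = (∫ ν, countChar t B ν ∂Q₁) * ∫ ν, countChar t B ν ∂Q₂ := by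
  rw [Measure.conv, integral_map (by fun_prop) (measurable_countChar t hB).aestronglyMeasurable,
    ← integral_prod_mul]
  refine integral_congr_ae ?_
  filter_upwards [Measure.quasiMeasurePreserving_fst.ae h₁,
    Measure.quasiMeasurePreserving_snd.ae h₂] with p _ _
  exact countChar_add t B p.1 p.2

end Convolution

section PoissonLaw

variable {X : Type*} [MeasurableSpace X] (Λ : Measure X)

/-- The `n`-th convolution power of the law of one point. As `Λ` is not normalized, this is
`Λ(X) ^ n` times the law of `n` independent points distributed according to `Λ / Λ(X)`. -/
noncomputable def pointsLaw : ℕ → Measure (Measure X)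
  | 0 => Measure.dirac 0
  | n + 1 => pointsLaw n ∗ Λ.map Measure.dirac

/-- The law of the Poisson process of finite intensity `Λ`, constructed as a Poisson number of
independent points. -/
noncomputable def poissonLaw : Measure (Measure X) :=
  ENNReal.ofReal (Real.exp (-Λ.real Set.univ)) •
    Measure.sum fun n : ℕ => (n.factorial : ℝ≥0∞)⁻¹ • pointsLaw Λ n

theorem poissonLaw_zero : poissonLaw (0 : Measure X) = Measure.dirac 0 := by
  ext A hA
  have hsucc (n : ℕ) (hn : n ≠ 0) : pointsLaw (0 : Measure X) n = 0 := by
    obtain ⟨m, rfl⟩ := Nat.exists_eq_succ_of_ne_zero hn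
    simp [pointsLaw]
  rw [poissonLaw, Measure.smul_apply, Measure.sum_apply _ hA,
    tsum_eq_single 0 fun n hn => by simp [hsucc n hn]]
  simp [pointsLaw]

theorem ae_isFiniteMeasure_map_dirac : ∀ᵐ ν ∂Λ.map Measure.dirac, IsFiniteMeasure ν := by
  rw [ae_map_iff Measure.measurable_dirac.aemeasurable
    FiniteMeasure.measurableSet_isFiniteMeasure]
  exact .of_forall fun x => inferInstance

theorem ae_isFiniteMeasure_pointsLaw (n : ℕ) : ∀ᵐ ν ∂pointsLaw Λ n, IsFiniteMeasure ν := by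
  induction n with
  | zero =>
    rw [pointsLaw, ae_dirac_iff FiniteMeasure.measurableSet_isFiniteMeasure]
    infer_instance
  | succ n ih => exact ae_isFiniteMeasure_conv ih (ae_isFiniteMeasure_map_dirac Λ)

variable [IsFiniteMeasure Λ]

instance (n : ℕ) : IsFiniteMeasure (pointsLaw Λ n) := by
  induction n with
  | zero => rw [pointsLaw]; infer_instance
  | succ n ih => rw [pointsLaw]; infer_instance

theorem pointsLaw_univ (n : ℕ) : pointsLaw Λ n Set.univ = Λ Set.univ ^ n := by
  induction n with
  | zero => simp [pointsLaw]
  | succ n ih =>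
    rw [pointsLaw, conv_univ, ih, Measure.map_apply Measure.measurable_dirac .univ, pow_succ,
      Set.preimage_univ]

theorem integral_countChar_pointsLaw {ι : Type*} [Fintype ι] (t : ι → ℝ) {B : ι → Set X}
    (hB : ∀ i, MeasurableSet (B i)) (n : ℕ) :
    ∫ ν, countChar t B ν ∂pointsLaw Λ n = (∫ x, countChar t B (Measure.dirac x) ∂Λ) ^ n := by
  induction n with
  | zero =>
    rw [pointsLaw, integral_dirac' _ _ (measurable_countChar t hB).stronglyMeasurable,
      countChar_zero, pow_zero]
  | succ n ih =>
    rw [pointsLaw, integral_countChar_conv (ae_isFiniteMeasure_pointsLaw Λ n)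
      (ae_isFiniteMeasure_map_dirac Λ) t hB, ih, pow_succ,
      integral_map Measure.measurable_dirac.aemeasurable
        (measurable_countChar t hB).aestronglyMeasurable]

theorem tsum_inv_factorial_mul_pow (r : ℝ) (hr : 0 ≤ r) :
    ∑' n : ℕ, (n.factorial : ℝ≥0∞)⁻¹ * ENNReal.ofReal r ^ n = ENNReal.ofReal (Real.exp r) := by
  have hsum := NormedSpace.expSeries_div_hasSum_exp r
  rw [← Real.exp_eq_exp_ℝ] at hsum
  rw [← hsum.tsum_eq, ENNReal.ofReal_tsum_of_nonneg (fun n => by positivity) hsum.summable]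
  refine tsum_congr fun n => ?_
  rw [ENNReal.ofReal_div_of_pos (by positivity), ENNReal.ofReal_pow hr, ENNReal.ofReal_natCast,
    ENNReal.div_eq_inv_mul]

theorem sum_pointsLaw_univ :
    Measure.sum (fun n : ℕ => (n.factorial : ℝ≥0∞)⁻¹ • pointsLaw Λ n) Set.univ =
      ENNReal.ofReal (Real.exp (Λ.real Set.univ)) := by
  rw [← tsum_inv_factorial_mul_pow _ measureReal_nonneg, ofReal_measureReal]
  simp only [Measure.sum_apply _ MeasurableSet.univ, Measure.smul_apply, smul_eq_mul,
    pointsLaw_univ]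

instance : IsProbabilityMeasure (poissonLaw Λ) := by
  constructor
  rw [poissonLaw, Measure.smul_apply, sum_pointsLaw_univ, smul_eq_mul,
    ← ENNReal.ofReal_mul (Real.exp_nonneg _), ← Real.exp_add, neg_add_cancel, Real.exp_zero,
    ENNReal.ofReal_one]

theorem le_poissonLaw_apply (A : Set (Measure X)) :
    ENNReal.ofReal (Real.exp (-Λ.real Set.univ)) *
      (Measure.dirac 0 A + Λ.map Measure.dirac A) ≤ poissonLaw Λ A := by
  rw [poissonLaw, Measure.smul_apply, smul_eq_mul]
  gcongr
  refine le_trans ?_ (Measure.le_sum_apply _ _)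
  refine le_trans (le_of_eq ?_) (ENNReal.sum_le_tsum (Finset.range 2))
  simp [Finset.sum_range_succ, pointsLaw]

end PoissonLaw

section HasPoissonChar

variable {X : Type*} [MeasurableSpace X] {Λ : Measure X} [IsFiniteMeasure Λ]

/-- `Q` is the law of a random finite measure with the characteristic functional of a Poisson
process of intensity `Λ`. Unlike `IsPoissonProcessLaw`, this is easily seen to be compatible with
convolution. -/
structure HasPoissonChar (Λ : Measure X) (Q : Measure (Measure X)) : Prop where
  isProbabilityMeasure : IsProbabilityMeasure Q
  ae_isFiniteMeasure : ∀ᵐ ν ∂Q, IsFiniteMeasure ν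
  integral_eq : ∀ (m : ℕ) (t : Fin m → ℝ) (B : Fin m → Set X), (∀ i, MeasurableSet (B i)) →
    ∫ ν, countChar t B ν ∂Q = Complex.exp (∫ x, (countChar t B (Measure.dirac x) - 1) ∂Λ)

theorem HasPoissonChar.conv {Λ₁ Λ₂ : Measure X} [IsFiniteMeasure Λ₁] [IsFiniteMeasure Λ₂]
    {Q₁ Q₂ : Measure (Measure X)} (h₁ : HasPoissonChar Λ₁ Q₁) (h₂ : HasPoissonChar Λ₂ Q₂) :
    HasPoissonChar (Λ₁ + Λ₂) (Q₁ ∗ Q₂) := by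
  have := h₁.isProbabilityMeasure
  have := h₂.isProbabilityMeasure
  refine ⟨inferInstance, ae_isFiniteMeasure_conv h₁.ae_isFiniteMeasure h₂.ae_isFiniteMeasure,
    fun m t B hB => ?_⟩
  have hint (Λ : Measure X) [IsFiniteMeasure Λ] :
      Integrable (fun x => countChar t B (Measure.dirac x) - 1) Λ :=
    (integrable_countChar_dirac t hB Λ).sub (integrable_const 1)
  rw [integral_countChar_conv h₁.ae_isFiniteMeasure h₂.ae_isFiniteMeasure t hB,
    h₁.integral_eq m t B hB, h₂.integral_eq m t B hB, ← Complex.exp_add,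
    integral_add_measure (hint Λ₁) (hint Λ₂)]

theorem hasPoissonChar_poissonLaw (Λ : Measure X) [IsFiniteMeasure Λ] :
    HasPoissonChar Λ (poissonLaw Λ) := by
  refine ⟨inferInstance, Measure.ae_smul_measure ?_ _, fun m t B hB => ?_⟩
  · exact Measure.ae_sum_iff.2 fun n => Measure.ae_smul_measure (ae_isFiniteMeasure_pointsLaw Λ n) _
  set z := ∫ x, countChar t B (Measure.dirac x) ∂Λ
  have : IsFiniteMeasure (Measure.sum fun n : ℕ => (n.factorial : ℝ≥0∞)⁻¹ • pointsLaw Λ n) :=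
    ⟨sum_pointsLaw_univ Λ ▸ ENNReal.ofReal_lt_top⟩
  have hsum : ∫ ν, countChar t B ν ∂Measure.sum
      (fun n : ℕ => (n.factorial : ℝ≥0∞)⁻¹ • pointsLaw Λ n) = Complex.exp z := by
    have hexp := NormedSpace.expSeries_div_hasSum_exp z
    rw [← Complex.exp_eq_exp_ℂ] at hexp
    refine (hasSum_integral_measure (integrable_countChar t hB _)).unique (hexp.congr_fun ?_)
    intro n
    simp [integral_smul_measure, integral_countChar_pointsLaw Λ t hB, z, div_eq_inv_mul]
  have hz : ∫ x, (countChar t B (Measure.dirac x) - 1) ∂Λ = -Λ.real Set.univ + z := by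
    rw [integral_sub (integrable_countChar_dirac t hB Λ) (integrable_const _)]
    simp [z, sub_eq_neg_add]
  rw [poissonLaw, integral_smul_measure, hsum, hz, Complex.exp_add,
    ENNReal.toReal_ofReal (Real.exp_nonneg _), Complex.real_smul]
  push_cast
  rfl

theorem HasPoissonChar.map_real_eq {Q : Measure (Measure X)} (h : HasPoissonChar Λ Q)
    {B : Set X} (hB : MeasurableSet B) :
    Q.map (fun ν => ν.real B) = (poissonMeasure (Λ B).toNNReal).map (fun k : ℕ => (k : ℝ)) := by
  have := h.isProbabilityMeasure
  have := Measure.isProbabilityMeasure_map (μ := Q) (measurable_measureReal hB).aemeasurable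
  refine Measure.ext_of_charFun (funext fun t => ?_)
  rw [charFun_map_cast_poissonMeasure, charFun_apply_real,
    integral_map (measurable_measureReal hB).aemeasurable (by fun_prop)]
  have hchar := h.integral_eq 1 (fun _ => t) (fun _ => B) (fun _ => hB)
  rw [integral_countChar_dirac_sub_one Λ _ (fun _ => hB) (Subsingleton.pairwise)] at hchar
  simp only [countChar, Finset.univ_unique, Finset.sum_singleton, Complex.ofReal_mul] at hchar
  exact hchar

theorem HasPoissonChar.iIndepFun_real {Q : Measure (Measure X)} (h : HasPoissonChar Λ Q) {m : ℕ}
    {B : Fin m → Set X} (hB : ∀ i, MeasurableSet (B i))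
    (hd : Pairwise (Function.onFun Disjoint B)) :
    iIndepFun (fun i (ν : Measure X) => ν.real (B i)) Q := by
  have := h.isProbabilityMeasure
  have hmeas (i : Fin m) := (measurable_measureReal (hB i)).aemeasurable (μ := Q)
  rw [iIndepFun_iff_charFun_pi hmeas]
  intro t
  have hchar := h.integral_eq m t B hB
  rw [integral_countChar_dirac_sub_one Λ _ hB hd, Complex.exp_sum] at hchar
  simp only [h.map_real_eq (hB _), charFun_map_cast_poissonMeasure]
  rw [charFun_apply, integral_map _ (by fun_prop)]
  · convert! hchar using 2
  · exact (WithLp.measurable_toLp 2 _).comp_aemeasurable (aemeasurable_pi_lambda _ hmeas)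

theorem HasPoissonChar.isPoissonProcessLaw {Q : Measure (Measure X)} (h : HasPoissonChar Λ Q) :
    IsPoissonProcessLaw Λ Q := by
  have hofReal (B : Set X) : (fun ν => ENNReal.ofReal (ν.real B)) =ᵐ[Q] fun ν => ν B := by
    filter_upwards [h.ae_isFiniteMeasure] with ν _
    exact ofReal_measureReal
  refine ⟨h.isProbabilityMeasure, fun B hB _ => ?_, fun m B hB hd => ?_⟩
  · calc Q.map (fun ν => ν B)
        = (Q.map fun ν => ν.real B).map ENNReal.ofReal := by
          rw [Measure.map_map ENNReal.measurable_ofReal (measurable_measureReal hB)]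
          exact (Measure.map_congr (hofReal B)).symm
      _ = (poissonMeasure (Λ B).toNNReal).map fun k : ℕ => (k : ℝ≥0∞) := by
          rw [h.map_real_eq hB, Measure.map_map ENNReal.measurable_ofReal (by fun_prop)]
          simp [Function.comp_def]
  · exact ((h.iIndepFun_real hB hd).comp (fun _ => ENNReal.ofReal)
      fun _ => ENNReal.measurable_ofReal).congr fun i => hofReal (B i)

end HasPoissonChar

section Uniqueness

variable {X : Type*} [MeasurableSpace X]

variable {Y : Type*} {ι : Type*}

theorem measurable_counts {B : ι → Set X} (hB : ∀ i, MeasurableSet (B i)) :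
    Measurable fun (ν : Measure X) i => ν (B i) :=
  measurable_pi_lambda _ fun i => Measure.measurable_coe (hB i)

theorem measurableSpace_measure_eq_comap : (inferInstance : MeasurableSpace (Measure X)) =
    MeasurableSpace.pi.comap fun ν (B : {B : Set X // MeasurableSet B}) => ν B := by
  change Measure.instMeasurableSpace = _
  rw [Measure.instMeasurableSpace, MeasurableSpace.pi, MeasurableSpace.comap_iSup, iSup_subtype]
  simp only [MeasurableSpace.comap_comp, Function.comp_def, BorelSpace.measurable_eq]

theorem measure_ext_of_map_counts {Q Q' : Measure (Measure X)} [IsFiniteMeasure Q]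
    (h : ∀ J : Finset {B : Set X // MeasurableSet B},
      Q.map (fun ν (B : J) => ν B.1.1) = Q'.map (fun ν (B : J) => ν B.1.1)) : Q = Q' := by
  let counts : Measure X → {B : Set X // MeasurableSet B} → ℝ≥0∞ := fun ν B => ν B
  have hcounts : Measurable counts := measurable_counts fun B => B.2
  have hmap : Q.map counts = Q'.map counts := by
    have hrestrict (R : Measure (Measure X)) (J : Finset {B : Set X // MeasurableSet B}) :
        (R.map counts).map J.restrict = R.map fun ν (B : J) => ν B.1.1 :=
      Measure.map_map (Finset.measurable_restrict J) hcounts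
    refine IsProjectiveLimit.unique (P := fun J => (Q.map counts).map J.restrict)
      (fun J => rfl) fun J => ?_
    simp only [hrestrict, h J]
  ext A hA
  obtain ⟨D, hD, rfl⟩ := measurableSpace_measure_eq_comap.le A hA
  have := congrArg (fun R => R D) hmap
  simpa only [Measure.map_apply hcounts hD] using this

/-- The set of the points that lie in exactly those sets `B i` for which `σ i` holds. The atoms of
a finite family are disjoint and generate it. -/
def atomOf (B : ι → Set Y) (σ : ι → Bool) : Set Y :=
  ⋂ i, if σ i then B i else (B i)ᶜ

theorem mem_atomOf {B : ι → Set Y} {σ : ι → Bool} {x : Y} :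
    x ∈ atomOf B σ ↔ ∀ i, (x ∈ B i ↔ σ i) := by
  simp only [atomOf, Set.mem_iInter]
  refine forall_congr' fun i => ?_
  cases σ i <;> simp

theorem pairwise_disjoint_atomOf (B : ι → Set Y) :
    Pairwise (Function.onFun Disjoint (atomOf B)) := by
  refine fun σ τ h => Set.disjoint_left.2 fun x hσ hτ => h (funext fun i => ?_)
  exact Bool.eq_iff_iff.2 ((mem_atomOf.1 hσ i).symm.trans (mem_atomOf.1 hτ i))

theorem measurableSet_atomOf [Finite ι] {B : ι → Set X} (hB : ∀ i, MeasurableSet (B i))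
    (σ : ι → Bool) : MeasurableSet (atomOf B σ) := by
  refine MeasurableSet.iInter fun i => ?_
  split_ifs
  exacts [hB i, (hB i).compl]

theorem measure_eq_sum_atomOf [Fintype ι] [DecidableEq ι] {B : ι → Set X}
    (hB : ∀ i, MeasurableSet (B i)) (ν : Measure X) (i : ι) :
    ν (B i) = ∑ σ : ι → Bool with σ i, ν (atomOf B σ) := by
  classical
  rw [← measure_biUnion_finset (fun σ _ τ _ h => pairwise_disjoint_atomOf B h)
    fun σ _ => measurableSet_atomOf hB σ]
  congr 1
  ext x
  simp only [Finset.mem_filter, Finset.mem_univ, true_and, Set.mem_iUnion, mem_atomOf, exists_prop]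
  exact ⟨fun hx => ⟨fun j => decide (x ∈ B j), by simp [hx], by simp⟩,
    fun ⟨σ, hσi, hσ⟩ => (hσ i).2 hσi⟩

variable {Λ : Measure X} [IsFiniteMeasure Λ] {Q Q' : Measure (Measure X)}

theorem IsPoissonProcessLaw.map_counts_eq_pi [Fintype ι] (h : IsPoissonProcessLaw Λ Q)
    {B : ι → Set X} (hB : ∀ i, MeasurableSet (B i))
    (hd : Pairwise (Function.onFun Disjoint B)) :
    Q.map (fun ν i => ν (B i)) = Measure.pi fun i =>
      (poissonMeasure (Λ (B i)).toNNReal).map fun k : ℕ => (k : ℝ≥0∞) := by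
  have := h.isProbabilityMeasure
  let e := Fintype.equivFin ι
  have hindep : iIndepFun (fun i (ν : Measure X) => ν (B i)) Q := by
    simpa using (h.indep _ (fun j => B (e.symm j)) (fun _ => hB _)
      (fun i j hij => hd (e.symm.injective.ne hij))).precomp e.injective
  rw [(iIndepFun_iff_map_fun_eq_pi_map fun i =>
    (Measure.measurable_coe (hB i)).aemeasurable).1 hindep]
  simp only [h.count_law _ (hB _) (measure_ne_top _ _)]

theorem IsPoissonProcessLaw.unique (h : IsPoissonProcessLaw Λ Q)
    (h' : IsPoissonProcessLaw Λ Q') : Q = Q' := by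
  classical
  have := h.isProbabilityMeasure
  refine measure_ext_of_map_counts fun J => ?_
  let B : J → Set X := fun A => A.1.1
  have hB (A : J) : MeasurableSet (B A) := A.1.2
  have hatoms := measurableSet_atomOf hB
  let sumAtoms (y : (J → Bool) → ℝ≥0∞) (A : J) : ℝ≥0∞ := ∑ σ : J → Bool with σ A, y σ
  have hsumAtoms : Measurable sumAtoms := by fun_prop
  have hmap (R : Measure (Measure X)) : R.map (fun ν A => ν (B A)) =
      (R.map fun ν σ => ν (atomOf B σ)).map sumAtoms := by
    rw [Measure.map_map hsumAtoms (measurable_counts hatoms)]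
    simp only [Function.comp_def, sumAtoms, ← measure_eq_sum_atomOf hB]
  rw [hmap Q, hmap Q', h.map_counts_eq_pi hatoms (pairwise_disjoint_atomOf B),
    h'.map_counts_eq_pi hatoms (pairwise_disjoint_atomOf B)]

theorem isPoissonProcessLaw_poissonLaw (Λ : Measure X) [IsFiniteMeasure Λ] :
    IsPoissonProcessLaw Λ (poissonLaw Λ) :=
  (hasPoissonChar_poissonLaw Λ).isPoissonProcessLaw

theorem poissonLaw_add (Λ₁ Λ₂ : Measure X) [IsFiniteMeasure Λ₁] [IsFiniteMeasure Λ₂] :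
    poissonLaw (Λ₁ + Λ₂) = poissonLaw Λ₁ ∗ poissonLaw Λ₂ :=
  (isPoissonProcessLaw_poissonLaw _).unique
    ((hasPoissonChar_poissonLaw Λ₁).conv (hasPoissonChar_poissonLaw Λ₂)).isPoissonProcessLaw

end Uniqueness

/-! ### Comparison of measures up to an additive error -/

section LeUpTo

variable {Y Z : Type*} [MeasurableSpace Y] [MeasurableSpace Z] {δ δ' : ℝ≥0∞}

/-- `μ` exceeds `ν` on no event by more than `δ`. For probability measures, this is a one-sided
form of a bound on the total variation distance. -/
def LeUpTo (μ ν : Measure Y) (δ : ℝ≥0∞) : Prop :=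
  ∀ A, MeasurableSet A → μ A ≤ ν A + δ

namespace LeUpTo

variable {μ ν ρ : Measure Y}

theorem trans (h : LeUpTo μ ν δ) (h' : LeUpTo ν ρ δ') : LeUpTo μ ρ (δ + δ') := fun A hA =>
  calc μ A ≤ ν A + δ := h A hA
    _ ≤ ρ A + δ' + δ := by gcongr; exact h' A hA
    _ = ρ A + (δ + δ') := by ring

theorem mono (h : LeUpTo μ ν δ) (hδ : δ ≤ δ') : LeUpTo μ ν δ' :=
  fun A hA => (h A hA).trans (by gcongr)

theorem map (h : LeUpTo μ ν δ) {f : Y → Z} (hf : Measurable f) :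
    LeUpTo (μ.map f) (ν.map f) δ := fun A hA => by
  rw [Measure.map_apply hf hA, Measure.map_apply hf hA]
  exact h _ (hf hA)

theorem add {μ' ν' : Measure Y} (h : LeUpTo μ ν δ) (h' : LeUpTo μ' ν' δ') :
    LeUpTo (μ + μ') (ν + ν') (δ + δ') := fun A hA => by
  rw [Measure.add_apply, Measure.add_apply, add_add_add_comm]
  exact add_le_add (h A hA) (h' A hA)

theorem prod_right [SFinite μ] [SFinite ν] (h : LeUpTo μ ν δ) (κ : Measure Z) [SFinite κ] :
    LeUpTo (μ.prod κ) (ν.prod κ) (δ * κ Set.univ) := fun A hA => by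
  rw [Measure.prod_apply_symm hA, Measure.prod_apply_symm hA, ← lintegral_const,
    ← lintegral_add_right _ measurable_const]
  exact lintegral_mono fun z => h _ (measurable_prodMk_right hA)

theorem prod_left [SFinite μ] [SFinite ν] (h : LeUpTo μ ν δ) (κ : Measure Z) [SFinite κ] :
    LeUpTo (κ.prod μ) (κ.prod ν) (δ * κ Set.univ) := fun A hA => by
  rw [Measure.prod_apply hA, Measure.prod_apply hA, ← lintegral_const,
    ← lintegral_add_right _ measurable_const]
  exact lintegral_mono fun z => h _ (measurable_prodMk_left hA)

theorem prod [IsProbabilityMeasure μ] [IsProbabilityMeasure ν] {μ' ν' : Measure Z}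
    [IsProbabilityMeasure μ'] [IsProbabilityMeasure ν'] (h : LeUpTo μ ν δ)
    (h' : LeUpTo μ' ν' δ') : LeUpTo (μ.prod μ') (ν.prod ν') (δ + δ') := by
  simpa only [measure_univ, mul_one] using (h.prod_right μ').trans (h'.prod_left ν)

theorem conv {M : Type*} [MeasurableSpace M] [AddMonoid M] [MeasurableAdd₂ M]
    {μ ν μ' ν' : Measure M} [IsProbabilityMeasure μ] [IsProbabilityMeasure ν]
    [IsProbabilityMeasure μ'] [IsProbabilityMeasure ν'] (h : LeUpTo μ ν δ)
    (h' : LeUpTo μ' ν' δ') : LeUpTo (μ ∗ μ') (ν ∗ ν') (δ + δ') :=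
  (h.prod h').map measurable_add

theorem of_add_eq {μ' ν' : Measure Y} [IsFiniteMeasure μ'] (h : LeUpTo ν' μ' δ)
    (heq : μ + μ' = ν + ν') : LeUpTo μ ν δ := fun A hA => by
  refine ENNReal.le_of_add_le_add_right (measure_ne_top μ' A) ?_
  calc μ A + μ' A = ν A + ν' A := by rw [← Measure.add_apply, heq, Measure.add_apply]
    _ ≤ ν A + (μ' A + δ) := by gcongr; exact h A hA
    _ = ν A + δ + μ' A := by ring

theorem symm [IsProbabilityMeasure μ] [IsProbabilityMeasure ν] (h : LeUpTo μ ν δ) :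
    LeUpTo ν μ δ := fun A hA => by
  have hcompl : ν A + ν Aᶜ = μ A + μ Aᶜ := by
    rw [measure_add_measure_compl hA, measure_add_measure_compl hA, measure_univ, measure_univ]
  refine ENNReal.le_of_add_le_add_right (measure_ne_top ν Aᶜ) ?_
  calc ν A + ν Aᶜ = μ A + μ Aᶜ := hcompl
    _ ≤ μ A + (ν Aᶜ + δ) := by gcongr; exact h _ hA.compl
    _ = μ A + δ + ν Aᶜ := by ring

theorem real_apply_le [IsFiniteMeasure μ] [IsFiniteMeasure ν] {δ : ℝ} (hδ : 0 ≤ δ)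
    (h : LeUpTo μ ν (ENNReal.ofReal δ)) {A : Set Y} (hA : MeasurableSet A) :
    μ.real A ≤ ν.real A + δ := by
  have := ENNReal.toReal_mono (by finiteness) (h A hA)
  rwa [ENNReal.toReal_add (by finiteness) (by finiteness), ENNReal.toReal_ofReal hδ] at this

theorem tvDist_le [IsProbabilityMeasure μ] [IsProbabilityMeasure ν] {δ : ℝ} (hδ : 0 ≤ δ)
    (h : LeUpTo μ ν (ENNReal.ofReal δ)) : tvDist μ ν ≤ δ := by
  have : Nonempty {A : Set Y // MeasurableSet A} := ⟨⟨∅, .empty⟩⟩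
  refine ciSup_le fun A => abs_sub_le_iff.2 ⟨?_, ?_⟩
  · linarith [h.real_apply_le hδ A.2]
  · linarith [h.symm.real_apply_le hδ A.2]

end LeUpTo

theorem leUpTo_map_of_eqOn_compl {μ : Measure Y} {f g : Y → Z} (hf : Measurable f)
    (hg : Measurable g) {U : Set Y} (hfg : Set.EqOn f g Uᶜ) :
    LeUpTo (μ.map f) (μ.map g) (μ U) := fun A hA => by
  rw [Measure.map_apply hf hA, Measure.map_apply hg hA]
  refine (measure_mono fun y hy => ?_).trans (measure_union_le _ _)
  by_cases hU : y ∈ U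
  · exact Or.inr hU
  · exact Or.inl (by rwa [Set.mem_preimage, ← hfg hU])

end LeUpTo

section Decoupling

variable {Ω Y Z : Type*} [MeasurableSpace Ω] [MeasurableSpace Y] [MeasurableSpace Z]
  {P : Measure Ω} {S S' : Ω → Y} {M : Ω → Z} {z : Z}

theorem map_restrict_ne_prodMk [IsFiniteMeasure P] (hS' : Measurable S') (hM : Measurable M)
    (hind : IndepFun S' M P) (hz : MeasurableSet {z}) :
    (P.restrict {ω | M ω ≠ z}).map (fun ω => (S' ω, M ω)) =
      (P.map S').prod ((P.restrict {ω | M ω ≠ z}).map M) := by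
  have hprod : P.map (fun ω => (S' ω, M ω)) = (P.map S').prod (P.map M) :=
    (indepFun_iff_map_prod_eq_prod_map_map hS'.aemeasurable hM.aemeasurable).1 hind
  have hV : {ω | M ω ≠ z} = (fun ω => (S' ω, M ω)) ⁻¹' Set.univ ×ˢ {z}ᶜ := by ext; simp
  have hV' : {ω | M ω ≠ z} = M ⁻¹' {z}ᶜ := rfl
  conv_lhs => rw [hV]
  rw [← Measure.restrict_map (hS'.prodMk hM) (.prod .univ hz.compl), hprod,
    ← Measure.prod_restrict, Measure.restrict_univ, hV', ← Measure.restrict_map hM hz.compl]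

theorem map_prodMk_eq_add (hS : Measurable S) (hM : Measurable M) (hz : MeasurableSet {z}) :
    P.map (fun ω => (S ω, M ω)) = (P.restrict {ω | M ω ≠ z}).map (fun ω => (S ω, M ω)) +
      ((P.restrict {ω | M ω = z}).map S).map fun y => (y, z) := by
  have heq : (P.restrict {ω | M ω = z}).map (fun ω => (S ω, M ω)) =
      ((P.restrict {ω | M ω = z}).map S).map fun y => (y, z) := by
    rw [Measure.map_map measurable_prodMk_right hS]
    refine Measure.map_congr ?_
    filter_upwards [ae_restrict_mem (hM hz)] with ω hω
    exact congrArg (Prod.mk (S ω)) hω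
  rw [← heq, ← Measure.map_add _ _ (hS.prodMk hM), add_comm]
  exact congrArg _ (Measure.restrict_add_restrict_compl (hM hz)).symm

theorem prod_map_eq_add [SFinite P] (hM : Measurable M) (hz : MeasurableSet {z}) (κ : Measure Y)
    [SFinite κ] : κ.prod (P.map M) = κ.prod ((P.restrict {ω | M ω ≠ z}).map M) +
      (P {ω | M ω = z} • κ).map fun y => (y, z) := by
  have heq : (P.restrict {ω | M ω = z}).map M = P {ω | M ω = z} • Measure.dirac z := by
    rw [← Measure.restrict_apply_univ, ← Measure.map_const]
    refine Measure.map_congr ?_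
    filter_upwards [ae_restrict_mem (hM hz)] with ω hω
    exact hω
  rw [Measure.map_smul, ← Measure.prod_dirac, ← Measure.prod_smul_right, ← heq,
    ← Measure.prod_add, ← Measure.map_add _ _ hM, add_comm]
  exact congrArg (fun R => κ.prod (R.map M)) (Measure.restrict_add_restrict_compl (hM hz)).symm

/-- The error involves only the event `M ≠ z`: the comparison on that event, both ways, also settles
the one on `M = z`, where the pair is determined by `S`, since the laws of `S` have the same
total. -/
theorem leUpTo_map_prodMk [IsProbabilityMeasure P] (hS : Measurable S) (hS' : Measurable S')
    (hM : Measurable M) (hind : IndepFun S' M P) (hz : MeasurableSet {z}) {U : Set Ω}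
    (hSS' : Set.EqOn S S' Uᶜ) :
    LeUpTo (P.map fun ω => (S ω, M ω)) ((P.map S).prod (P.map M))
      (2 * (P {ω | M ω ≠ z} * P U + P ({ω | M ω ≠ z} ∩ U))) := by
  set V : Set Ω := {ω | M ω ≠ z}
  have hV : MeasurableSet V := hM hz.compl
  have : IsProbabilityMeasure (P.map S) := Measure.isProbabilityMeasure_map hS.aemeasurable
  set ρ := (P.restrict V).map M
  have hρ : ρ Set.univ = P V := by
    rw [Measure.map_apply hM .univ, Set.preimage_univ, Measure.restrict_apply_univ]
  have hδ : P V * P U + P (V ∩ U) = P U * ρ Set.univ + P.restrict V U := by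
    rw [hρ, Measure.restrict_apply' hV, Set.inter_comm U, mul_comm (P U)]
  have hpair : Set.EqOn (fun ω => (S ω, M ω)) (fun ω => (S' ω, M ω)) Uᶜ :=
    fun ω hω => congrArg (·, M ω) (hSS' hω)
  have hprod := map_restrict_ne_prodMk hS' hM hind hz
  have hne : LeUpTo ((P.restrict V).map fun ω => (S ω, M ω)) ((P.map S).prod ρ)
      (P V * P U + P (V ∩ U)) := by
    rw [hδ, add_comm]
    exact (leUpTo_map_of_eqOn_compl (hS.prodMk hM) (hS'.prodMk hM) hpair).trans
      (hprod ▸ (leUpTo_map_of_eqOn_compl hS' hS hSS'.symm).prod_right ρ)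
  have hne' : LeUpTo ((P.map S).prod ρ) ((P.restrict V).map fun ω => (S ω, M ω))
      (P V * P U + P (V ∩ U)) := by
    rw [hδ]
    exact ((leUpTo_map_of_eqOn_compl hS hS' hSS').prod_right ρ).trans
      (hprod ▸ leUpTo_map_of_eqOn_compl (hS'.prodMk hM) (hS.prodMk hM) hpair.symm)
  have heq : LeUpTo ((P.restrict {ω | M ω = z}).map S) (P {ω | M ω = z} • P.map S)
      (P V * P U + P (V ∩ U)) := by
    have hfst := hne'.map measurable_fst
    rw [Measure.map_fst_prod, hρ, Measure.map_map measurable_fst (hS.prodMk hM)] at hfst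
    refine hfst.of_add_eq ?_
    rw [Function.comp_def, ← Measure.map_add _ _ hS, ← add_smul]
    have hrestrict := Measure.restrict_add_restrict_compl (μ := P) (hM hz)
    have hmass := measure_add_measure_compl (μ := P) (hM hz)
    rw [measure_univ] at hmass
    exact (congrArg _ hrestrict).trans ((congrArg (· • _) hmass).trans (one_smul _ _)).symm
  rw [map_prodMk_eq_add hS hM hz, prod_map_eq_add hM hz, two_mul]
  exact hne.add (heq.map measurable_prodMk_right)

end Decoupling

/-! ### Coupling -/

section Coupling

universe u v

variable {W : Type u} {Y : Type v} [MeasurableSpace W] [MeasurableSpace Y]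

theorem LeUpTo.one_le_inf {μ ν : Measure Y} [IsProbabilityMeasure μ] [IsProbabilityMeasure ν]
    {δ : ℝ≥0∞} (h : LeUpTo μ ν δ) : 1 ≤ (μ ⊓ ν) Set.univ + δ := by
  rw [Measure.inf_apply .univ, ENNReal.sInf_add]
  refine le_iInf₂ fun x hx => ?_
  obtain ⟨t, rfl⟩ := hx
  simp only [Set.inter_univ]
  have hνt : ν t ≤ μ t + δ :=
    calc ν t ≤ ν (toMeasurable μ t) := measure_mono (subset_toMeasurable μ t)
      _ ≤ μ (toMeasurable μ t) + δ := h.symm _ (measurableSet_toMeasurable μ t)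
      _ = μ t + δ := by rw [measure_toMeasurable]
  calc (1 : ℝ≥0∞) = ν (t ∪ tᶜ) := by rw [Set.union_compl_self, measure_univ]
    _ ≤ ν t + ν tᶜ := measure_union_le _ _
    _ ≤ μ t + δ + ν tᶜ := by gcongr
    _ = μ t + ν tᶜ + δ := by ring

theorem exists_add_eq_map_eq_of_le_map {μ : Measure W} [IsFiniteMeasure μ] {F : W → Y}
    (hF : Measurable F) {κ : Measure Y} (hκ : κ ≤ μ.map F) :
    ∃ μ₁ μ₂ : Measure W, μ₁ + μ₂ = μ ∧ μ₁.map F = κ := by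
  have : IsFiniteMeasure κ := isFiniteMeasure_of_le _ hκ
  let g : Y → ℝ≥0∞ := fun y => min 1 (κ.rnDeriv (μ.map F) y)
  have hg : Measurable g := measurable_const.min (Measure.measurable_rnDeriv _ _)
  have hκg : (μ.map F).withDensity g = κ := by
    rw [← Measure.withDensity_rnDeriv_eq κ (μ.map F) (Measure.absolutelyContinuous_of_le hκ)]
    refine withDensity_congr_ae ?_
    filter_upwards [Measure.rnDeriv_le_one_of_le hκ] with y hy
    exact min_eq_right hy
  refine ⟨μ.withDensity (g ∘ F), μ.withDensity (1 - g ∘ F), ?_, ?_⟩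
  · have hsum : g ∘ F + (1 - g ∘ F) = 1 := funext fun w => add_tsub_cancel_of_le (min_le_left _ _)
    rw [← withDensity_add_left (hg.comp hF), hsum, withDensity_one]
  · rw [← hκg]
    ext A hA
    rw [Measure.map_apply hF hA, withDensity_apply _ (hF hA), withDensity_apply _ hA,
      setLIntegral_map hA hg hF]
    rfl

theorem exists_map_fst_eq_map_snd_eq (μ : Measure W) (ρ : Measure Y) [IsFiniteMeasure μ]
    [IsFiniteMeasure ρ] (h : μ Set.univ = ρ Set.univ) :
    ∃ π : Measure (W × Y), π.map Prod.fst = μ ∧ π.map Prod.snd = ρ := by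
  by_cases h0 : μ Set.univ = 0
  · refine ⟨0, ?_, ?_⟩
    · rw [Measure.map_zero, Measure.measure_univ_eq_zero.1 h0]
    · rw [Measure.map_zero, Measure.measure_univ_eq_zero.1 (h.symm.trans h0)]
  · have hinv : (μ Set.univ)⁻¹ * μ Set.univ = 1 := ENNReal.inv_mul_cancel h0 (measure_ne_top _ _)
    refine ⟨(μ Set.univ)⁻¹ • μ.prod ρ, ?_, ?_⟩
    · rw [Measure.map_smul, Measure.map_fst_prod, ← h, smul_smul, hinv, one_smul]
    · rw [Measure.map_smul, Measure.map_snd_prod, smul_smul, hinv, one_smul]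

theorem exists_sum_coupling (μ₁ : Measure W) (π : Measure (W × Y)) {F : W → Y}
    (hF : Measurable F) :
    ∃ (Ω : Type (max u v)) (_ : MeasurableSpace Ω) (P : Measure Ω) (X : Ω → W) (η : Ω → Y),
      Measurable X ∧ Measurable η ∧ P.map X = μ₁ + π.map Prod.fst ∧
      P.map η = μ₁.map F + π.map Prod.snd ∧ P {ω | η ω ≠ F (X ω)} ≤ π Set.univ := by
  have hX : Measurable (Sum.elim id Prod.fst : W ⊕ W × Y → W) :=
    measurable_id.sumElim measurable_fst
  have hη : Measurable (Sum.elim F Prod.snd : W ⊕ W × Y → Y) := hF.sumElim measurable_snd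
  refine ⟨W ⊕ W × Y, inferInstance, μ₁.map Sum.inl + π.map Sum.inr, _, _, hX, hη, ?_, ?_, ?_⟩
  · rw [Measure.map_add _ _ hX, Measure.map_map hX measurable_inl,
      Measure.map_map hX measurable_inr, Sum.elim_comp_inl, Sum.elim_comp_inr, Measure.map_id]
  · rw [Measure.map_add _ _ hη, Measure.map_map hη measurable_inl,
      Measure.map_map hη measurable_inr, Sum.elim_comp_inl, Sum.elim_comp_inr]
  · have hsub : {ω : W ⊕ W × Y | Sum.elim F Prod.snd ω ≠ F (Sum.elim id Prod.fst ω)} ⊆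
        Set.range Sum.inr := by
      rintro (w | p) hω
      · exact absurd rfl hω
      · exact Set.mem_range_self p
    refine (measure_mono hsub).trans_eq ?_
    rw [Measure.add_apply, Measure.map_apply measurable_inl measurableSet_range_inr,
      Measure.map_apply measurable_inr measurableSet_range_inr, Set.preimage_inl_range_inr,
      measure_empty, zero_add, Set.preimage_range]

/-- The two variables agree on the common part `μ.map F ⊓ Q` of their laws. -/
theorem LeUpTo.exists_coupling {μ : Measure W} [IsProbabilityMeasure μ] {Q : Measure Y}
    [IsProbabilityMeasure Q] {F : W → Y} (hF : Measurable F) {δ : ℝ≥0∞}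
    (h : LeUpTo (μ.map F) Q δ) :
    ∃ (Ω : Type (max u v)) (_ : MeasurableSpace Ω) (P : Measure Ω) (X : Ω → W) (η : Ω → Y),
      Measurable X ∧ Measurable η ∧ P.map X = μ ∧ P.map η = Q ∧
      P {ω | η ω ≠ F (X ω)} ≤ δ := by
  have : IsProbabilityMeasure (μ.map F) := Measure.isProbabilityMeasure_map hF.aemeasurable
  obtain ⟨κ, hκF, hκQ, hκδ⟩ : ∃ κ, κ ≤ μ.map F ∧ κ ≤ Q ∧ 1 ≤ κ Set.univ + δ :=
    ⟨_, inf_le_left, inf_le_right, h.one_le_inf⟩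
  have : IsFiniteMeasure κ := isFiniteMeasure_of_le Q hκQ
  obtain ⟨μ₁, μ₂, hμ, hμκ⟩ := exists_add_eq_map_eq_of_le_map hF hκF
  have : IsFiniteMeasure μ₂ := isFiniteMeasure_of_le μ (hμ ▸ Measure.le_add_left le_rfl)
  have hQ : Q - κ + κ = Q := Measure.sub_add_cancel_of_le hκQ
  have hμ₁ : μ₁ Set.univ = κ Set.univ := by
    rw [← hμκ, Measure.map_apply hF .univ, Set.preimage_univ]
  have hmass : μ₂ Set.univ + κ Set.univ = 1 := by
    rw [← hμ₁, add_comm, ← Measure.add_apply, hμ, measure_univ]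
  have hmass' : (Q - κ) Set.univ + κ Set.univ = 1 := by
    rw [← Measure.add_apply, hQ, measure_univ]
  obtain ⟨π, hfst, hsnd⟩ := exists_map_fst_eq_map_snd_eq μ₂ (Q - κ)
    ((ENNReal.add_left_inj (measure_ne_top κ _)).1 (hmass.trans hmass'.symm))
  obtain ⟨Ω, _, P, X, η, hX, hη, hPX, hPη, hne⟩ := exists_sum_coupling μ₁ π hF
  refine ⟨Ω, _, P, X, η, hX, hη, by rw [hPX, hfst, hμ],
    by rw [hPη, hsnd, hμκ, add_comm, hQ], hne.trans ?_⟩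
  have hπ : π Set.univ = μ₂ Set.univ := by
    rw [← hfst, Measure.map_apply measurable_fst .univ, Set.preimage_univ]
  refine ENNReal.le_of_add_le_add_right (measure_ne_top κ Set.univ) ?_
  rwa [hπ, hmass, add_comm]

end Coupling

/-! ### Poisson approximation of a sum of dependent points -/

section OptPoint

variable {Ω X : Type*} [MeasurableSpace X]

open Classical in
/-- The point process consisting of the point `f ω` if `ω ∈ V`, and of no point otherwise. -/
noncomputable def optPoint (V : Set Ω) (f : Ω → X) (ω : Ω) : Measure X :=
  if ω ∈ V then Measure.dirac (f ω) else 0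

theorem optPoint_of_mem {V : Set Ω} (f : Ω → X) {ω : Ω} (h : ω ∈ V) :
    optPoint V f ω = Measure.dirac (f ω) := if_pos h

theorem optPoint_of_notMem {V : Set Ω} (f : Ω → X) {ω : Ω} (h : ω ∉ V) :
    optPoint V f ω = 0 := if_neg h

theorem optPoint_ne_zero_iff {V : Set Ω} {f : Ω → X} {ω : Ω} :
    optPoint V f ω ≠ 0 ↔ ω ∈ V := by
  by_cases h : ω ∈ V
  · simp only [optPoint_of_mem f h, h, iff_true]
    exact NeZero.ne _
  · simp only [optPoint_of_notMem f h, h, ne_eq, not_true_eq_false]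

theorem measurableSet_singleton_zero_measure : MeasurableSet {(0 : Measure X)} := by
  have h : {(0 : Measure X)} = (fun ν : Measure X => ν Set.univ) ⁻¹' {0} := by
    ext ν
    simp
  rw [h]
  exact Measure.measurable_coe .univ (measurableSet_singleton 0)

variable [MeasurableSpace Ω]

theorem measurable_optPoint {V : Set Ω} (hV : MeasurableSet V) {f : Ω → X} (hf : Measurable f) :
    Measurable (optPoint V f) := by
  classical
  exact Measurable.ite hV (Measure.measurable_dirac.comp hf) measurable_const

/-- The intensity of `optPoint V f` under `P`. -/
noncomputable def pointIntensity (P : Measure Ω) (V : Set Ω) (f : Ω → X) : Measure X :=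
  (P.restrict V).map f

theorem pointIntensity_univ (P : Measure Ω) (V : Set Ω) {f : Ω → X} (hf : Measurable f) :
    pointIntensity P V f Set.univ = P V := by
  rw [pointIntensity, Measure.map_apply hf .univ, Set.preimage_univ, Measure.restrict_apply_univ]

theorem lintegral_optPoint (P : Measure Ω) {V : Set Ω} (hV : MeasurableSet V) {f : Ω → X}
    (hf : Measurable f) {B : Set X} (hB : MeasurableSet B) :
    ∫⁻ ω, optPoint V f ω B ∂P = pointIntensity P V f B := by
  rw [pointIntensity, Measure.map_apply hf hB, ← lintegral_indicator_one (hf hB),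
    ← lintegral_indicator hV]
  refine lintegral_congr fun ω => ?_
  by_cases hω : ω ∈ V
  · rw [optPoint_of_mem f hω, Measure.dirac_apply' _ hB, Set.indicator_of_mem hω]
    rfl
  · rw [optPoint_of_notMem f hω, Set.indicator_of_notMem hω]
    rfl

instance (P : Measure Ω) [IsFiniteMeasure P] (V : Set Ω) (f : Ω → X) :
    IsFiniteMeasure (pointIntensity P V f) :=
  inferInstanceAs (IsFiniteMeasure ((P.restrict V).map f))

theorem map_optPoint {P : Measure Ω} {V : Set Ω} (hV : MeasurableSet V) {f : Ω → X}
    (hf : Measurable f) : P.map (optPoint V f) =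
      P Vᶜ • Measure.dirac 0 + (pointIntensity P V f).map Measure.dirac := by
  have hmem : (P.restrict V).map (optPoint V f) = (pointIntensity P V f).map Measure.dirac := by
    rw [pointIntensity, Measure.map_map Measure.measurable_dirac hf]
    refine Measure.map_congr ?_
    filter_upwards [ae_restrict_mem hV] with ω hω
    exact optPoint_of_mem f hω
  have hnotMem : (P.restrict Vᶜ).map (optPoint V f) = P Vᶜ • Measure.dirac 0 := by
    rw [← Measure.restrict_apply_univ, ← Measure.map_const]
    refine Measure.map_congr ?_
    filter_upwards [ae_restrict_mem hV.compl] with ω hω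
    exact optPoint_of_notMem f hω
  rw [← hmem, ← hnotMem, ← Measure.map_add _ _ (measurable_optPoint hV hf), add_comm,
    Measure.restrict_add_restrict_compl hV]

variable {P : Measure Ω} [IsProbabilityMeasure P]

theorem leUpTo_optPoint_poissonLaw {V : Set Ω} (hV : MeasurableSet V) {f : Ω → X}
    (hf : Measurable f) :
    LeUpTo (P.map (optPoint V f)) (poissonLaw (pointIntensity P V f)) (P V ^ 2) := by
  intro A hA
  refine le_trans ?_ (add_le_add_left (le_poissonLaw_apply (pointIntensity P V f) A) _)
  rw [map_optPoint hV hf, Measure.add_apply, Measure.smul_apply, smul_eq_mul]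
  have hreal : (pointIntensity P V f).real Set.univ = P.real V := by
    rw [measureReal_def, pointIntensity_univ P V hf, measureReal_def]
  have hb : (pointIntensity P V f).map Measure.dirac A ≤ P V := by
    rw [← pointIntensity_univ P V hf, Measure.map_apply Measure.measurable_dirac hA]
    exact measure_mono (Set.subset_univ _)
  have hq : P Vᶜ ≤ ENNReal.ofReal (Real.exp (-(pointIntensity P V f).real Set.univ)) := by
    rw [hreal, ← ofReal_measureReal, probReal_compl_eq_one_sub hV]
    exact ENNReal.ofReal_le_ofReal (Real.one_sub_le_exp_neg _)
  set θ := ENNReal.ofReal (Real.exp (-(pointIntensity P V f).real Set.univ))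
  set d := Measure.dirac (0 : Measure X) A
  set b := (pointIntensity P V f).map Measure.dirac A
  calc P Vᶜ * d + b = P Vᶜ * d + (P Vᶜ + P V) * b := by
        rw [add_comm (P Vᶜ), measure_add_measure_compl hV, measure_univ, one_mul]
    _ = P Vᶜ * (d + b) + P V * b := by ring
    _ ≤ θ * (d + b) + P V * P V := by gcongr
    _ = θ * (d + b) + P V ^ 2 := by rw [sq]

end OptPoint

section PoissonApproximation

variable {Ω X ι : Type*} [MeasurableSpace X]

theorem sum_optPoint_filter_not_of_notMem (V : ι → Set Ω) (f : ι → Ω → X)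
    (p : ι → Prop) [DecidablePred p] (s : Finset ι) {ω : Ω} (hω : ω ∉ ⋃ j ∈ s.filter p, V j) :
    ∑ j ∈ s with ¬ p j, optPoint (V j) (f j) ω = ∑ j ∈ s, optPoint (V j) (f j) ω := by
  refine Finset.sum_subset (Finset.filter_subset _ _) fun j hj hj' => ?_
  have hp : p j := by simpa [hj] using hj'
  exact optPoint_of_notMem _ fun hV =>
    hω (Set.mem_biUnion (Finset.mem_coe.2 (Finset.mem_filter.2 ⟨hj, hp⟩)) hV)

variable [MeasurableSpace Ω] [DecidableEq ι]

/-- The error term of the Poisson approximation of a sum of points, where the `i`-th point is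
present on `V i` and depends only on the points `j` with `R i j`. -/
noncomputable def dependenceError (P : Measure Ω) (V : ι → Set Ω) (R : ι → ι → Prop)
    [DecidableRel R] (s : Finset ι) : ℝ≥0∞ :=
  ∑ i ∈ s, (P (V i) ^ 2 +
    2 * ∑ j ∈ s with j ≠ i ∧ R i j, (P (V i) * P (V j) + P (V i ∩ V j)))

theorem le_dependenceError_insert (P : Measure Ω) (V : ι → Set Ω) (R : ι → ι → Prop)
    [DecidableRel R] {s : Finset ι} {i : ι} (his : i ∉ s) :
    2 * (P (V i) * P (⋃ j ∈ s.filter (R i), V j) + P (V i ∩ ⋃ j ∈ s.filter (R i), V j)) +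
      (dependenceError P V R s + P (V i) ^ 2) ≤ dependenceError P V R (insert i s) := by
  have hfilter : (insert i s).filter (fun j => j ≠ i ∧ R i j) = s.filter (R i) := by
    ext j
    simp only [Finset.mem_filter, Finset.mem_insert]
    constructor
    · rintro ⟨hj, hne, hR⟩
      exact ⟨hj.resolve_left hne, hR⟩
    · rintro ⟨hj, hR⟩
      exact ⟨Or.inr hj, fun h => his (h ▸ hj), hR⟩
  have hunion : P (V i) * P (⋃ j ∈ s.filter (R i), V j) + P (V i ∩ ⋃ j ∈ s.filter (R i), V j) ≤
      ∑ j ∈ s with R i j, (P (V i) * P (V j) + P (V i ∩ V j)) := by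
    rw [Finset.sum_add_distrib, ← Finset.mul_sum, Set.inter_iUnion₂]
    gcongr
    · exact measure_biUnion_finset_le _ _
    · exact measure_biUnion_finset_le _ _
  have hmono : dependenceError P V R s ≤ ∑ k ∈ s, (P (V k) ^ 2 +
      2 * ∑ j ∈ insert i s with j ≠ k ∧ R k j, (P (V k) * P (V j) + P (V k ∩ V j))) := by
    rw [dependenceError]
    gcongr with k
    exact Finset.subset_insert i s
  have hinsert : dependenceError P V R (insert i s) =
      (P (V i) ^ 2 + 2 * ∑ j ∈ s with R i j, (P (V i) * P (V j) + P (V i ∩ V j))) +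
        ∑ k ∈ s, (P (V k) ^ 2 +
          2 * ∑ j ∈ insert i s with j ≠ k ∧ R k j, (P (V k) * P (V j) + P (V k ∩ V j))) := by
    rw [dependenceError, Finset.sum_insert his, hfilter]
  rw [hinsert, add_comm _ (P (V i) ^ 2), add_left_comm, ← add_assoc]
  gcongr

/-- The points are replaced one at a time by independent Poisson processes. -/
theorem leUpTo_sum_optPoint (P : Measure Ω) [IsProbabilityMeasure P] {V : ι → Set Ω}
    (hV : ∀ i, MeasurableSet (V i)) {f : ι → Ω → X} (hf : ∀ i, Measurable (f i))
    (R : ι → ι → Prop) [DecidableRel R]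
    (hind : ∀ i (T : Finset ι), (∀ j ∈ T, ¬ R i j) →
      IndepFun (fun ω => ∑ j ∈ T, optPoint (V j) (f j) ω) (optPoint (V i) (f i)) P)
    (s : Finset ι) :
    LeUpTo (P.map fun ω => ∑ i ∈ s, optPoint (V i) (f i) ω)
      (poissonLaw (∑ i ∈ s, pointIntensity P (V i) (f i))) (dependenceError P V R s) := by
  have hpoint : ∀ j, Measurable (optPoint (V j) (f j)) :=
    fun j => measurable_optPoint (hV j) (hf j)
  have hsum : ∀ T : Finset ι, Measurable fun ω => ∑ j ∈ T, optPoint (V j) (f j) ω :=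
    fun T => Finset.measurable_sum _ fun j _ => hpoint j
  induction s using Finset.induction_on with
  | empty =>
    intro A _
    simp [poissonLaw_zero]
  | insert i s his ih =>
    have : IsProbabilityMeasure (P.map fun ω => ∑ j ∈ s, optPoint (V j) (f j) ω) :=
      Measure.isProbabilityMeasure_map (hsum s).aemeasurable
    have : IsProbabilityMeasure (P.map (optPoint (V i) (f i))) :=
      Measure.isProbabilityMeasure_map (hpoint i).aemeasurable
    have hdecouple := (leUpTo_map_prodMk (hsum s) (hsum (s.filter fun j => ¬ R i j)) (hpoint i)
      (hind i _ fun j hj => (Finset.mem_filter.1 hj).2) measurableSet_singleton_zero_measure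
      fun ω hω => (sum_optPoint_filter_not_of_notMem V f (R i) s hω).symm).map measurable_add
    simp only [optPoint_ne_zero_iff, Set.ofPred_mem_eq] at hdecouple
    rw [Measure.map_map measurable_add ((hsum s).prodMk (hpoint i))] at hdecouple
    have hreplace := hdecouple.trans (ih.conv (leUpTo_optPoint_poissonLaw (hV i) (hf i)))
    rw [← poissonLaw_add] at hreplace
    simp only [Finset.sum_insert his, add_comm (optPoint _ _ _), add_comm (pointIntensity _ _ _)]
    exact hreplace.mono (le_dependenceError_insert P V R his)

end PoissonApproximation

/-! ### Exponential weights -/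

section Weights

theorem measurable_exponentialPDF (r : ℝ) : Measurable (exponentialPDF r) :=
  (measurable_exponentialPDFReal r).ennreal_ofReal

theorem expMeasure_eq_withDensity (r : ℝ) :
    expMeasure r = volume.withDensity (exponentialPDF r) := rfl

theorem ae_expMeasure_nonneg (r : ℝ) : ∀ᵐ x ∂expMeasure r, 0 ≤ x := by
  rw [expMeasure_eq_withDensity, ae_withDensity_iff (measurable_exponentialPDF r)]
  refine .of_forall fun x hx => ?_
  by_contra h
  exact hx (exponentialPDF_of_neg (not_le.1 h))

theorem lintegral_exp_neg_mul_expMeasure {r θ : ℝ} (hr : 0 < r) (hθ : 0 ≤ θ) :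
    ∫⁻ x, ENNReal.ofReal (Real.exp (-(θ * x))) ∂expMeasure r = ENNReal.ofReal (r / (r + θ)) := by
  have hrθ : 0 < r + θ := by positivity
  have hpdf (x : ℝ) : exponentialPDF r x * ENNReal.ofReal (Real.exp (-(θ * x))) =
      ENNReal.ofReal (r / (r + θ)) * exponentialPDF (r + θ) x := by
    rcases lt_or_ge x 0 with hx | hx
    · rw [exponentialPDF_of_neg hx, exponentialPDF_of_neg hx, zero_mul, mul_zero]
    · rw [exponentialPDF_of_nonneg hx, exponentialPDF_of_nonneg hx,
        ← ENNReal.ofReal_mul (by positivity), ← ENNReal.ofReal_mul (by positivity), mul_assoc,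
        ← Real.exp_add, ← mul_assoc, div_mul_cancel₀ r hrθ.ne', ← neg_add, add_mul]
  rw [expMeasure_eq_withDensity,
    lintegral_withDensity_eq_lintegral_mul _ (measurable_exponentialPDF r) (by fun_prop)]
  simp only [Pi.mul_apply, hpdf]
  rw [lintegral_const_mul _ (measurable_exponentialPDF _), lintegral_exponentialPDF_eq_one hrθ,
    mul_one]

theorem measurableSet_isLight {E : Type*} (n : ℕ) (c : ℝ) (C : Finset E) :
    MeasurableSet {w : E → ℝ | IsLight n w c C} :=
  measurableSet_le (measurable_meanWeight C) measurable_const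

theorem IsLight.sum_le {E : Type*} {n : ℕ} {w : E → ℝ} {c : ℝ} {C : Finset E} (hn : 0 < n)
    (hC : C.Nonempty) (h : IsLight n w c C) : n * ∑ e ∈ C, w e ≤ c * C.card := by
  have hcard : (0 : ℝ) < C.card := Nat.cast_pos.2 hC.card_pos
  rw [IsLight, meanWeight, div_le_div_iff₀ hcard (Nat.cast_pos.2 hn)] at h
  rwa [mul_comm]

variable {E : Type*} [Fintype E]

instance : IsProbabilityMeasure (expMeasure 1) := isProbabilityMeasure_expMeasure one_pos

instance : IsProbabilityMeasure (weightLaw E) :=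
  inferInstanceAs (IsProbabilityMeasure (Measure.pi fun _ => expMeasure 1))

theorem ae_weightLaw_nonneg : ∀ᵐ w ∂weightLaw E, ∀ e, 0 ≤ w e :=
  ae_all_iff.2 fun e =>
    (Measure.quasiMeasurePreserving_eval (μ := fun _ : E => expMeasure 1) e).ae
      (ae_expMeasure_nonneg 1)

theorem lintegral_exp_neg_sum_weightLaw (T : Finset E) {θ : ℝ} (hθ : 0 ≤ θ) :
    ∫⁻ w, ENNReal.ofReal (Real.exp (-(θ * ∑ e ∈ T, w e))) ∂weightLaw E =
      ENNReal.ofReal (1 / (1 + θ)) ^ T.card := by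
  have hmeas : Measurable fun x : ℝ => ENNReal.ofReal (Real.exp (-(θ * x))) := by fun_prop
  have hprod (w : E → ℝ) : ENNReal.ofReal (Real.exp (-(θ * ∑ e ∈ T, w e))) =
      ∏ e ∈ T, ENNReal.ofReal (Real.exp (-(θ * w e))) := by
    rw [← ENNReal.ofReal_prod_of_nonneg (fun _ _ => (Real.exp_pos _).le), ← Real.exp_sum,
      Finset.sum_neg_distrib, Finset.mul_sum]
  have hind : iIndepFun (fun (e : E) (w : E → ℝ) => ENNReal.ofReal (Real.exp (-(θ * w e))))
      (weightLaw E) :=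
    iIndepFun_pi (X := fun _ x => ENNReal.ofReal (Real.exp (-(θ * x)))) fun _ => hmeas.aemeasurable
  simp only [hprod]
  rw [lintegral_prod_eq_prod_lintegral_of_indepFun T _ hind
    fun e => hmeas.comp (measurable_pi_apply e)]
  refine Finset.prod_eq_pow_card fun e _ => ?_
  rw [← lintegral_exp_neg_mul_expMeasure one_pos hθ]
  exact (measurePreserving_eval (fun _ : E => expMeasure 1) e).lintegral_comp hmeas

theorem weightLaw_mul_sum_le (T : Finset E) {θ : ℝ} (hθ : 0 < θ) (a : ℝ) :
    weightLaw E {w | θ * ∑ e ∈ T, w e ≤ a} ≤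
      ENNReal.ofReal (Real.exp a) * ENNReal.ofReal θ⁻¹ ^ T.card := by
  have hset : {w : E → ℝ | θ * ∑ e ∈ T, w e ≤ a} = {w | 1 ≤ ENNReal.ofReal (Real.exp a) *
      ENNReal.ofReal (Real.exp (-(θ * ∑ e ∈ T, w e)))} := by
    ext w
    rw [Set.mem_ofPred_eq, Set.mem_ofPred_eq, ← ENNReal.ofReal_mul (Real.exp_nonneg a),
      ← Real.exp_add, ← sub_eq_add_neg, ENNReal.one_le_ofReal, Real.one_le_exp_iff, sub_nonneg]
  calc weightLaw E {w | θ * ∑ e ∈ T, w e ≤ a}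
      ≤ ∫⁻ w, ENNReal.ofReal (Real.exp a) *
          ENNReal.ofReal (Real.exp (-(θ * ∑ e ∈ T, w e))) ∂weightLaw E := by
        rw [hset, ← one_mul (weightLaw E _)]
        exact mul_meas_ge_le_lintegral (by fun_prop) 1
    _ = ENNReal.ofReal (Real.exp a) * ENNReal.ofReal (1 / (1 + θ)) ^ T.card := by
        rw [lintegral_const_mul _ (by fun_prop), lintegral_exp_neg_sum_weightLaw T hθ.le]
    _ ≤ ENNReal.ofReal (Real.exp a) * ENNReal.ofReal θ⁻¹ ^ T.card := by
        rw [← one_div θ]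
        gcongr
        exact le_add_of_nonneg_left zero_le_one

theorem weightLaw_isLight_inter_le [DecidableEq E] {n : ℕ} (hn : 0 < n) (c : ℝ) {C D : Finset E}
    (hC : C.Nonempty) (hD : D.Nonempty) :
    weightLaw E ({w | IsLight n w c C} ∩ {w | IsLight n w c D}) ≤
      ENNReal.ofReal (Real.exp (c * (C.card + D.card))) *
        ENNReal.ofReal (n : ℝ)⁻¹ ^ (C ∪ D).card := by
  refine le_trans (measure_mono_ae ?_) (weightLaw_mul_sum_le (C ∪ D) (Nat.cast_pos.2 hn) _)
  filter_upwards [ae_weightLaw_nonneg (E := E)] with w hw ⟨hlightC, hlightD⟩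
  calc n * ∑ e ∈ C ∪ D, w e ≤ n * (∑ e ∈ C, w e + ∑ e ∈ D, w e) := by
        rw [← Finset.sum_union_inter]
        gcongr
        exact le_add_of_nonneg_right (Finset.sum_nonneg fun e _ => hw e)
    _ ≤ c * (C.card + D.card) := by
        linarith [hlightC.sum_le hn hC, hlightD.sum_le hn hD]

end Weights

/-! ### Combinatorics of cycles -/

theorem zmod_forall_of_add_one {k : ℕ} [NeZero k] {p : ZMod k → Prop} (j : ZMod k) (hj : p j)
    (hp : ∀ i, p i → p (i + 1)) (i : ZMod k) : p i := by
  have hshift (m : ℕ) : p (j + m) := by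
    induction m with
    | zero => simpa only [Nat.cast_zero, add_zero] using hj
    | succ m ih => simpa only [Nat.cast_add, Nat.cast_one, add_assoc] using hp _ ih
  simpa only [ZMod.natCast_zmod_val, add_sub_cancel] using hshift (i - j).val

theorem zmod_add_one_ne_sub_one {k : ℕ} (hk : 3 ≤ k) (i : ZMod k) : i + 1 ≠ i - 1 := by
  intro h
  have h2 : ((2 : ℕ) : ZMod k) = 0 := by
    push_cast
    linear_combination h
  rw [ZMod.natCast_eq_zero_iff] at h2
  exact absurd (Nat.le_of_dvd two_pos h2) (by lia)

theorem exists_injective_range_eq_of_image_eq_range {ι E T : Type*} {val : E → T}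
    {edge : ι → T} (hedge : Function.Injective edge) (hval : Function.Injective val) {s : Set E}
    (h : val '' s = Set.range edge) :
    ∃ e : ι → E, Function.Injective e ∧ (∀ i, val (e i) = edge i) ∧ s = Set.range e := by
  have hex (i : ι) : ∃ x ∈ s, val x = edge i := by
    rw [← Set.mem_image, h]
    exact Set.mem_range_self i
  choose e _ hval_e using hex
  have hcomp : val ∘ e = edge := funext hval_e
  refine ⟨e, (hcomp ▸ hedge).of_comp, hval_e, hval.image_injective ?_⟩
  rw [h, ← Set.range_comp, hcomp]

section Cycles

variable {V E : Type*} {J : V → V → E → Prop} {C D : Finset E}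

/-- `C` is the set of the edges `e i` of the closed walk through the distinct vertices `v i`.
Here and below, `J x y e` means that the edge `e` leads from `x` to `y`. -/
structure IsTraversal (J : V → V → E → Prop) {k : ℕ} (v : ZMod k → V) (e : ZMod k → E)
    (C : Finset E) : Prop where
  vertex_injective : Function.Injective v
  edge_injective : Function.Injective e
  joins (i : ZMod k) : J (v i) (v (i + 1)) (e i)
  coe_eq_range : (C : Set E) = Set.range e

/-- `𝒞` is a family of cycles of a graph in which `J x y e` means that the edge `e` leads from `x`
to `y`. This treats directed and undirected graphs together: in the latter, `J x y e` and `J y x e`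
are equivalent. -/
structure IsCycleFamily (J : V → V → E → Prop) (𝒞 : Set (Finset E)) : Prop where
  edge_eq {x y : V} {e e' : E} : J x y e → J x y e' → e = e'
  ends_eq {x y x' y' : V} {e : E} : J x y e → J x' y' e → s(x, y) = s(x', y')
  exists_isTraversal {C : Finset E} : C ∈ 𝒞 →
    ∃ k : ℕ, 2 ≤ k ∧ ∃ (v : ZMod k → V) (e : ZMod k → E), IsTraversal J v e C

theorem isCycleFamily_dirCycles (V : Type*) :
    IsCycleFamily (fun x y (e : DirEdge V) => e.1 = (x, y)) (dirCycles V) where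
  edge_eq h h' := Subtype.ext (h.trans h'.symm)
  ends_eq h h' := congrArg (fun p : V × V => s(p.1, p.2)) (h.symm.trans h')
  exists_isTraversal := by
    rintro C ⟨k, hk, v, hv, hC⟩
    obtain ⟨e, he, hve, hrange⟩ := exists_injective_range_eq_of_image_eq_range
      (fun i j hij => hv (congrArg Prod.fst hij)) Subtype.val_injective hC
    exact ⟨k, hk, v, e, hv, he, hve, hrange⟩

theorem sym2_walk_injective {k : ℕ} (hk : 3 ≤ k) {v : ZMod k → V} (hv : Function.Injective v) :
    Function.Injective fun i => s(v i, v (i + 1)) := by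
  intro i j h
  rcases Sym2.eq_iff.1 h with ⟨hi, -⟩ | ⟨hi, hi'⟩
  · exact hv hi
  · refine absurd ?_ (zmod_add_one_ne_sub_one hk j)
    rw [← hv hi, eq_sub_iff_add_eq, hv hi']

theorem isCycleFamily_undirCycles (V : Type*) :
    IsCycleFamily (fun x y (e : UndirEdge V) => e.1 = s(x, y)) (undirCycles V) where
  edge_eq h h' := Subtype.ext (h.trans h'.symm)
  ends_eq h h' := h.symm.trans h'
  exists_isTraversal := by
    rintro C ⟨k, hk, v, hv, hC⟩
    obtain ⟨e, he, hve, hrange⟩ := exists_injective_range_eq_of_image_eq_range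
      (sym2_walk_injective hk hv) Subtype.val_injective hC
    exact ⟨k, by lia, v, e, hv, he, hve, hrange⟩

namespace IsTraversal

variable {k : ℕ} {v : ZMod k → V} {e : ZMod k → E}

theorem mem_iff (h : IsTraversal J v e C) {d : E} : d ∈ C ↔ ∃ i, e i = d := by
  rw [← Finset.mem_coe, h.coe_eq_range, Set.mem_range]

theorem eq_map [NeZero k] (h : IsTraversal J v e C) :
    C = Finset.univ.map ⟨e, h.edge_injective⟩ :=
  Finset.coe_injective (by simpa using h.coe_eq_range)

theorem card_eq [NeZero k] (h : IsTraversal J v e C) : C.card = k := by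
  rw [h.eq_map, Finset.card_map, Finset.card_univ, ZMod.card]

end IsTraversal

namespace IsCycleFamily

variable {𝒞 : Set (Finset E)}

theorem two_le_card (h : IsCycleFamily J 𝒞) (hC : C ∈ 𝒞) : 2 ≤ C.card := by
  obtain ⟨k, hk, v, e, htr⟩ := h.exists_isTraversal hC
  have : NeZero k := ⟨by lia⟩
  rwa [htr.card_eq]

theorem nonempty (h : IsCycleFamily J 𝒞) (hC : C ∈ 𝒞) : C.Nonempty :=
  Finset.card_pos.1 (two_pos.trans_le (h.two_le_card hC))

theorem exists_isTraversal_of_card_eq (h : IsCycleFamily J 𝒞) {k : ℕ} (hC : C ∈ 𝒞)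
    (hk : C.card = k) : ∃ (v : ZMod k → V) (e : ZMod k → E), IsTraversal J v e C := by
  obtain ⟨l, hl, v, e, htr⟩ := h.exists_isTraversal hC
  have : NeZero l := ⟨by lia⟩
  obtain rfl : l = k := htr.card_eq.symm.trans hk
  exact ⟨v, e, htr⟩

theorem mem_range_of_joins (h : IsCycleFamily J 𝒞) {k : ℕ} {v : ZMod k → V} {e : ZMod k → E}
    (hv : IsTraversal J v e C) {d : E} (hd : d ∈ C) {x y : V} (hxy : J x y d) :
    x ∈ Set.range v ∧ y ∈ Set.range v := by
  obtain ⟨i, rfl⟩ := hv.mem_iff.1 hd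
  rcases Sym2.eq_iff.1 (h.ends_eq hxy (hv.joins i)) with ⟨rfl, rfl⟩ | ⟨rfl, rfl⟩
  · exact ⟨Set.mem_range_self _, Set.mem_range_self _⟩
  · exact ⟨Set.mem_range_self _, Set.mem_range_self _⟩

theorem eq_or_eq_sub_one_of_edge_eq (h : IsCycleFamily J 𝒞) {k l : ℕ} {u : ZMod k → V}
    {e : ZMod k → E} {v : ZMod l → V} {e' : ZMod l → E} (hu : IsTraversal J u e C)
    (hv : IsTraversal J v e' D) {a b : ZMod k} {i j : ZMod l} (hva : v i = u a)
    (hj : j = i ∨ j = i - 1) (hb : e b = e' j) : b = a ∨ b = a - 1 := by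
  have hends : s(u b, u (b + 1)) = s(v j, v (j + 1)) :=
    h.ends_eq (hu.joins b) (hb ▸ hv.joins j)
  have hmem : u a ∈ s(u b, u (b + 1)) := by
    rw [hends, ← hva]
    rcases hj with rfl | rfl
    · exact Sym2.mem_mk_left _ _
    · rw [sub_add_cancel]
      exact Sym2.mem_mk_right _ _
  rcases Sym2.mem_iff.1 hmem with hab | hab
  · exact Or.inl (hu.vertex_injective hab).symm
  · exact Or.inr (eq_sub_of_add_eq (hu.vertex_injective hab).symm)

/-- At a common vertex, the two edges of `D` are edges of `C`, so they are the two edges of `C`;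
hence `D` follows `C` to the next vertex. -/
theorem eq_of_subset (h : IsCycleFamily J 𝒞) (hC : C ∈ 𝒞) (hD : D ∈ 𝒞) (hDC : D ⊆ C) :
    D = C := by
  obtain ⟨k, hk, u, e, hu⟩ := h.exists_isTraversal hC
  obtain ⟨l, hl, v, e', hv⟩ := h.exists_isTraversal hD
  have : NeZero k := ⟨by lia⟩
  have : NeZero l := ⟨by lia⟩
  have : Fact (1 < l) := ⟨hl⟩
  have hedge (j : ZMod l) : ∃ b, e b = e' j := hu.mem_iff.1 (hDC (hv.mem_iff.2 ⟨j, rfl⟩))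
  have hvisit {a : ZMod k} {i : ZMod l} (hva : v i = u a) : ∃ j, e a = e' j := by
    obtain ⟨b, hb⟩ := hedge i
    obtain ⟨b', hb'⟩ := hedge (i - 1)
    have hne : b ≠ b' := by
      rintro rfl
      have hi : i = i - 1 := hv.edge_injective (hb.symm.trans hb')
      exact one_ne_zero (sub_eq_self.1 hi.symm)
    rcases h.eq_or_eq_sub_one_of_edge_eq hu hv hva (Or.inl rfl) hb with rfl | rfl
    · exact ⟨i, hb⟩
    rcases h.eq_or_eq_sub_one_of_edge_eq hu hv hva (Or.inr rfl) hb' with rfl | rfl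
    · exact ⟨i - 1, hb'⟩
    exact absurd rfl hne
  have hvisits_all : ∀ a, u a ∈ Set.range v := by
    obtain ⟨b, hb⟩ := hedge 0
    refine zmod_forall_of_add_one b ?_ fun a ⟨i, hi⟩ => ?_
    · exact (h.mem_range_of_joins hv (hv.mem_iff.2 ⟨0, hb.symm⟩) (hu.joins b)).1
    · obtain ⟨j, hj⟩ := hvisit hi
      exact (h.mem_range_of_joins hv (hv.mem_iff.2 ⟨j, hj.symm⟩) (hu.joins a)).2
  refine hDC.antisymm fun d hd => ?_
  obtain ⟨a, rfl⟩ := hu.mem_iff.1 hd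
  obtain ⟨i, hi⟩ := hvisits_all a
  obtain ⟨j, hj⟩ := hvisit hi
  exact hv.mem_iff.2 ⟨j, hj.symm⟩

section Vertices

variable [Fintype V]

open Classical in
/-- The vertices of a set of edges. -/
noncomputable def vertsOf (J : V → V → E → Prop) (C : Finset E) : Finset V :=
  {x | ∃ e ∈ C, ∃ y, J x y e ∨ J y x e}

theorem mem_vertsOf_left {x y : V} {e : E} (he : e ∈ C) (hxy : J x y e) : x ∈ vertsOf J C := by
  simp only [vertsOf, Finset.mem_filter, Finset.mem_univ, true_and]
  exact ⟨e, he, y, Or.inl hxy⟩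

theorem mem_vertsOf_right {x y : V} {e : E} (he : e ∈ C) (hxy : J x y e) : y ∈ vertsOf J C := by
  simp only [vertsOf, Finset.mem_filter, Finset.mem_univ, true_and]
  exact ⟨e, he, x, Or.inr hxy⟩

theorem vertsOf_eq_map (h : IsCycleFamily J 𝒞) {k : ℕ} [NeZero k] {v : ZMod k → V}
    {e : ZMod k → E} (hv : IsTraversal J v e C) :
    vertsOf J C = Finset.univ.map ⟨v, hv.vertex_injective⟩ := by
  ext x
  simp only [Finset.mem_map, Finset.mem_univ, true_and, Function.Embedding.coeFn_mk]
  constructor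
  · intro hx
    simp only [vertsOf, Finset.mem_filter, Finset.mem_univ, true_and] at hx
    obtain ⟨d, hd, y, hxy | hyx⟩ := hx
    · exact (h.mem_range_of_joins hv hd hxy).1
    · exact (h.mem_range_of_joins hv hd hyx).2
  · rintro ⟨i, rfl⟩
    exact mem_vertsOf_left (hv.mem_iff.2 ⟨i, rfl⟩) (hv.joins i)

theorem card_vertsOf (h : IsCycleFamily J 𝒞) (hC : C ∈ 𝒞) : (vertsOf J C).card = C.card := by
  obtain ⟨k, hk, v, e, hv⟩ := h.exists_isTraversal hC
  have : NeZero k := ⟨by lia⟩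
  rw [h.vertsOf_eq_map hv, Finset.card_map, Finset.card_univ, ZMod.card, hv.card_eq]

/-- Otherwise the walk along `D`, which enters `C` at a common edge, never leaves `C`. -/
theorem exists_edge_leaving (h : IsCycleFamily J 𝒞) (hC : C ∈ 𝒞) (hD : D ∈ 𝒞) (hne : D ≠ C)
    {d : E} (hdC : d ∈ C) (hdD : d ∈ D) {l : ℕ} [NeZero l] {v : ZMod l → V} {e : ZMod l → E}
    (hv : IsTraversal J v e D) : ∃ i, v i ∈ vertsOf J C ∧ e i ∉ C := by
  by_contra! hstay
  obtain ⟨j, rfl⟩ := hv.mem_iff.1 hdD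
  have hverts : ∀ i, v i ∈ vertsOf J C :=
    zmod_forall_of_add_one j (mem_vertsOf_left hdC (hv.joins j))
      fun i hi => mem_vertsOf_right (hstay i hi) (hv.joins i)
  refine hne (h.eq_of_subset hC hD fun d hd => ?_)
  obtain ⟨i, rfl⟩ := hv.mem_iff.1 hd
  exact hstay i (hverts i)

/-- The walk along `D` has an edge that starts in `C` without being an edge of `C`, in addition to
the edges that start outside of `C`. -/
theorem card_vertsOf_sdiff_lt [DecidableEq V] [DecidableEq E] (h : IsCycleFamily J 𝒞) (hC : C ∈ 𝒞)
    (hD : D ∈ 𝒞) (hne : D ≠ C) (hCD : (C ∩ D).Nonempty) :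
    (vertsOf J D \ vertsOf J C).card < (D \ C).card := by
  obtain ⟨d, hd⟩ := hCD
  obtain ⟨hdC, hdD⟩ := Finset.mem_inter.1 hd
  obtain ⟨l, hl, v, e, hv⟩ := h.exists_isTraversal hD
  have : NeZero l := ⟨by lia⟩
  obtain ⟨i₀, hi₀, hi₀C⟩ := h.exists_edge_leaving hC hD hne hdC hdD hv
  let S : Finset (ZMod l) := {i | v i ∉ vertsOf J C}
  have hS : vertsOf J D \ vertsOf J C = S.map ⟨v, hv.vertex_injective⟩ := by
    rw [h.vertsOf_eq_map hv, Finset.sdiff_eq_filter, Finset.filter_map]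
    rfl
  have hi₀S : i₀ ∉ S := fun hi => (Finset.mem_filter.1 hi).2 hi₀
  have hsub : (insert i₀ S).map ⟨e, hv.edge_injective⟩ ⊆ D \ C := by
    intro d hd
    obtain ⟨i, hi, rfl⟩ := Finset.mem_map.1 hd
    refine Finset.mem_sdiff.2 ⟨hv.mem_iff.2 ⟨i, rfl⟩, ?_⟩
    rcases Finset.mem_insert.1 hi with rfl | hi
    · exact hi₀C
    · exact fun hC => (Finset.mem_filter.1 hi).2 (mem_vertsOf_left hC (hv.joins i))
  calc (vertsOf J D \ vertsOf J C).card < (insert i₀ S).card := by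
        rw [hS, Finset.card_map, Finset.card_insert_of_notMem hi₀S]
        exact Nat.lt_succ_self _
    _ ≤ (D \ C).card := by
        rw [← Finset.card_map]
        exact Finset.card_le_card hsub

end Vertices

end IsCycleFamily

end Cycles

/-! ### Counting pairs of cycles -/

section Counting

variable {V E : Type*} {J : V → V → E → Prop} {𝒞 : Set (Finset E)}

theorem IsCycleFamily.eq_of_isTraversal (h : IsCycleFamily J 𝒞) {k : ℕ} {v : ZMod k → V}
    {e e' : ZMod k → E} {C D : Finset E} (hC : IsTraversal J v e C) (hD : IsTraversal J v e' D) :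
    C = D := by
  have he : e = e' := funext fun i => h.edge_eq (hC.joins i) (hD.joins i)
  exact Finset.coe_injective (by rw [hC.coe_eq_range, hD.coe_eq_range, he])

namespace IsCycleFamily

variable [Fintype V] {s : Finset (Finset E)}

section Sums

variable {R : Type*} [CommSemiring R] [PartialOrder R] [CanonicallyOrderedAdd R]

theorem sum_prod_vertsOf_le_pow (h : IsCycleFamily J 𝒞) {k : ℕ}
    (hs : ∀ C ∈ s, C ∈ 𝒞 ∧ C.card = k) (g : V → R) :
    ∑ C ∈ s, ∏ x ∈ vertsOf J C, g x ≤ (∑ x, g x) ^ k := by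
  classical
  rcases eq_or_ne k 0 with rfl | hk
  · have hempty : s = ∅ := Finset.eq_empty_of_forall_notMem fun C hC =>
      (h.nonempty (hs C hC).1).ne_empty (Finset.card_eq_zero.1 (hs C hC).2)
    simp [hempty]
  have : NeZero k := ⟨hk⟩
  choose v e hv using fun C : s =>
    h.exists_isTraversal_of_card_eq (hs C C.2).1 (hs C C.2).2
  have hv_injective : Function.Injective v := fun C D hCD =>
    Subtype.ext (h.eq_of_isTraversal (hv C) (hCD ▸ hv D))
  calc ∑ C ∈ s, ∏ x ∈ vertsOf J C, g x = ∑ C : s, ∏ i, g (v C i) := by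
        rw [← Finset.sum_coe_sort]
        refine Finset.sum_congr rfl fun C _ => ?_
        rw [h.vertsOf_eq_map (hv C), Finset.prod_map]
        rfl
    _ = ∑ p ∈ Finset.univ.map ⟨v, hv_injective⟩, ∏ i, g (p i) := by
        rw [Finset.sum_map]
        rfl
    _ ≤ ∑ p : ZMod k → V, ∏ i, g (p i) := Finset.sum_le_sum_of_subset (Finset.subset_univ _)
    _ = (∑ x, g x) ^ k := by
        rw [← Fintype.prod_sum, Finset.prod_const, Finset.card_univ, ZMod.card]

variable [IsOrderedRing R]

theorem sum_prod_vertsOf_le (h : IsCycleFamily J 𝒞) {L : ℕ}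
    (hs : ∀ C ∈ s, C ∈ 𝒞 ∧ C.card ≤ L) {g : V → R} {b : R} (hg : ∑ x, g x ≤ b) (hb : 1 ≤ b) :
    ∑ C ∈ s, ∏ x ∈ vertsOf J C, g x ≤ (L + 1) * b ^ L := by
  calc ∑ C ∈ s, ∏ x ∈ vertsOf J C, g x
      = ∑ k ∈ Finset.range (L + 1), ∑ C ∈ s with C.card = k, ∏ x ∈ vertsOf J C, g x :=
        (Finset.sum_fiberwise_of_maps_to
          (fun C hC => Finset.mem_range_succ_iff.2 (hs C hC).2) _).symm
    _ ≤ ∑ _k ∈ Finset.range (L + 1), b ^ L := by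
        refine Finset.sum_le_sum fun k hk => ?_
        have hsk : ∀ C ∈ s.filter fun C => C.card = k, C ∈ 𝒞 ∧ C.card = k := fun C hC =>
          ⟨(hs C (Finset.mem_filter.1 hC).1).1, (Finset.mem_filter.1 hC).2⟩
        calc _ ≤ (∑ x, g x) ^ k := h.sum_prod_vertsOf_le_pow hsk g
          _ ≤ b ^ k := pow_le_pow_left₀ zero_le hg k
          _ ≤ b ^ L := pow_le_pow_right₀ hb (Finset.mem_range_succ_iff.1 hk)
    _ = (L + 1) * b ^ L := by
        rw [Finset.sum_const, Finset.card_range, nsmul_eq_mul, Nat.cast_succ]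

theorem sum_pow_card_le (h : IsCycleFamily J 𝒞) {L : ℕ}
    (hs : ∀ C ∈ s, C ∈ 𝒞 ∧ C.card ≤ L) {q : R} (hq : (Fintype.card V : R) * q ≤ 1) :
    ∑ C ∈ s, q ^ C.card ≤ L + 1 := by
  have hsum : ∑ _x : V, q ≤ 1 := by
    rwa [Finset.sum_const, Finset.card_univ, nsmul_eq_mul]
  calc ∑ C ∈ s, q ^ C.card = ∑ C ∈ s, ∏ _x ∈ vertsOf J C, q :=
        Finset.sum_congr rfl fun C hC => by
          rw [Finset.prod_const, h.card_vertsOf (hs C hC).1]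
    _ ≤ (L + 1) * 1 ^ L := h.sum_prod_vertsOf_le hs hsum le_rfl
    _ = L + 1 := by rw [one_pow, mul_one]

theorem sum_pow_card_vertsOf_sdiff_le [DecidableEq V] (h : IsCycleFamily J 𝒞)
    {L : ℕ} (hs : ∀ C ∈ s, C ∈ 𝒞 ∧ C.card ≤ L) {q : R} (hq : (Fintype.card V : R) * q ≤ 1)
    {A : Finset V} (hA : A.card ≤ L) :
    ∑ C ∈ s, q ^ (vertsOf J C \ A).card ≤ ((L + 1) ^ (L + 1) : R) := by
  have hsum : ∑ x : V, (if x ∈ A then 1 else q) ≤ (L + 1 : R) := by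
    calc ∑ x : V, (if x ∈ A then 1 else q) ≤ ∑ x : V, ((if x ∈ A then 1 else 0) + q) := by
          gcongr with x
          split_ifs
          · exact le_self_add
          · rw [zero_add]
      _ = A.card + Fintype.card V * q := by
          simp [Finset.sum_add_distrib, nsmul_eq_mul]
      _ ≤ L + 1 := by
          gcongr
  calc ∑ C ∈ s, q ^ (vertsOf J C \ A).card
      = ∑ C ∈ s, ∏ x ∈ vertsOf J C, (if x ∈ A then 1 else q) :=
        Finset.sum_congr rfl fun C _ => by
          rw [Finset.prod_ite, Finset.prod_const_one, one_mul, Finset.prod_const,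
            Finset.filter_notMem_eq_sdiff]
    _ ≤ (L + 1) * (L + 1) ^ L := h.sum_prod_vertsOf_le hs hsum le_add_self
    _ = (L + 1) ^ (L + 1) := (pow_succ' _ _).symm

end Sums

section DependenceError

variable [DecidableEq E] {Ω : Type*} [MeasurableSpace Ω] {P : Measure Ω} {A : Finset E → Set Ω}
  {K q : ℝ≥0∞}

/-- Together, `C` and `D` have more edges than vertices, which gains a factor `q`. -/
theorem mul_add_inter_le [DecidableEq V] (h : IsCycleFamily J 𝒞) (hs : ∀ C ∈ s, C ∈ 𝒞)
    (hK : 1 ≤ K) (hq : q ≤ 1)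
    (hP : ∀ C ∈ s, ∀ D ∈ s, P (A C ∩ A D) ≤ K * q ^ (C ∪ D).card) {C D : Finset E} (hC : C ∈ s)
    (hD : D ∈ s) (hne : D ≠ C) (hCD : (C ∩ D).Nonempty) :
    P (A C) * P (A D) + P (A C ∩ A D) ≤
      2 * K ^ 2 * q * q ^ C.card * q ^ (vertsOf J D \ vertsOf J C).card := by
  have hsingle (B : Finset E) (hB : B ∈ s) : P (A B) ≤ K * q ^ B.card := by
    simpa only [Set.inter_self, Finset.union_self] using hP B hB B hB
  have hlt := h.card_vertsOf_sdiff_lt (hs C hC) (hs D hD) hne hCD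
  have hunion : (C ∪ D).card = C.card + (D \ C).card := by
    rw [← Finset.union_sdiff_self_eq_union, Finset.card_union_of_disjoint Finset.disjoint_sdiff]
  have hunion_le : (C ∪ D).card ≤ C.card + D.card := Finset.card_union_le C D
  calc P (A C) * P (A D) + P (A C ∩ A D)
      ≤ (K * q ^ C.card) * (K * q ^ D.card) + K * q ^ (C ∪ D).card := by
        gcongr
        exacts [hsingle C hC, hsingle D hD, hP C hC D hD]
    _ = K ^ 2 * q ^ (C.card + D.card) + K * q ^ (C ∪ D).card := by ring
    _ ≤ K ^ 2 * q ^ (C ∪ D).card + K ^ 2 * q ^ (C ∪ D).card := by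
        gcongr ?_ + ?_ * _
        · exact mul_le_mul_right (pow_le_pow_right_of_le_one' hq hunion_le) _
        · exact le_self_pow₀ hK two_ne_zero
    _ = 2 * K ^ 2 * q ^ (C ∪ D).card := by ring
    _ ≤ 2 * K ^ 2 * q ^ (1 + C.card + (vertsOf J D \ vertsOf J C).card) := by
        gcongr 2 * K ^ 2 * ?_
        exact pow_le_pow_right_of_le_one' hq (by lia)
    _ = 2 * K ^ 2 * q * q ^ C.card * q ^ (vertsOf J D \ vertsOf J C).card := by ring

theorem sq_add_sum_inter_le [DecidableEq V] (h : IsCycleFamily J 𝒞) (hs : ∀ C ∈ s, C ∈ 𝒞)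
    (hK : 1 ≤ K) (hq : q ≤ 1)
    (hP : ∀ C ∈ s, ∀ D ∈ s, P (A C ∩ A D) ≤ K * q ^ (C ∪ D).card) {C : Finset E} (hC : C ∈ s) :
    P (A C) ^ 2 + 2 * ∑ D ∈ s with D ≠ C ∧ (C ∩ D).Nonempty,
        (P (A C) * P (A D) + P (A C ∩ A D)) ≤
      4 * K ^ 2 * q * q ^ C.card * ∑ D ∈ s, q ^ (vertsOf J D \ vertsOf J C).card := by
  have hcard : 1 + C.card ≤ C.card * 2 := by
    have := h.two_le_card (hs C hC)
    lia
  have hsq : P (A C) ^ 2 ≤ 4 * K ^ 2 * q * q ^ C.card := by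
    calc P (A C) ^ 2 ≤ (K * q ^ C.card) ^ 2 := by
          gcongr
          simpa only [Set.inter_self, Finset.union_self] using hP C hC C hC
      _ = 1 * K ^ 2 * q ^ (C.card * 2) := by ring
      _ ≤ 4 * K ^ 2 * q ^ (1 + C.card) := by
          gcongr ?_ * K ^ 2 * ?_
          · norm_num
          · exact pow_le_pow_right_of_le_one' hq hcard
      _ = 4 * K ^ 2 * q * q ^ C.card := by ring
  have hsub : {D ∈ s | D ≠ C ∧ (C ∩ D).Nonempty} ⊆ s.erase C := fun D hD => by
    obtain ⟨hDs, hne, -⟩ := Finset.mem_filter.1 hD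
    exact Finset.mem_erase.2 ⟨hne, hDs⟩
  calc _ ≤ 4 * K ^ 2 * q * q ^ C.card + 2 * ∑ D ∈ s with D ≠ C ∧ (C ∩ D).Nonempty,
          2 * K ^ 2 * q * q ^ C.card * q ^ (vertsOf J D \ vertsOf J C).card := by
        gcongr with D hD
        obtain ⟨hDs, hne, hCD⟩ := Finset.mem_filter.1 hD
        exact h.mul_add_inter_le hs hK hq hP hC hDs hne hCD
    _ ≤ 4 * K ^ 2 * q * q ^ C.card + 2 * ∑ D ∈ s.erase C,
          2 * K ^ 2 * q * q ^ C.card * q ^ (vertsOf J D \ vertsOf J C).card := by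
        gcongr
    _ = 4 * K ^ 2 * q * q ^ C.card * ∑ D ∈ s, q ^ (vertsOf J D \ vertsOf J C).card := by
        rw [← Finset.add_sum_erase s _ hC, sdiff_self, Finset.bot_eq_empty, Finset.card_empty,
          pow_zero, ← Finset.mul_sum]
        ring

theorem dependenceError_le (h : IsCycleFamily J 𝒞) {L : ℕ} (hs : ∀ C ∈ s, C ∈ 𝒞 ∧ C.card ≤ L)
    (hK : 1 ≤ K) (hq : q ≤ 1) (hVq : (Fintype.card V : ℝ≥0∞) * q ≤ 1)
    (hP : ∀ C ∈ s, ∀ D ∈ s, P (A C ∩ A D) ≤ K * q ^ (C ∪ D).card) :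
    dependenceError P A (fun C D => (C ∩ D).Nonempty) s ≤
      4 * K ^ 2 * (L + 1) ^ (L + 2) * q := by
  classical
  have hs𝒞 : ∀ C ∈ s, C ∈ 𝒞 := fun C hC => (hs C hC).1
  have hcard : ∀ C ∈ s, (vertsOf J C).card ≤ L := fun C hC =>
    (h.card_vertsOf (hs𝒞 C hC)).trans_le (hs C hC).2
  calc dependenceError P A (fun C D => (C ∩ D).Nonempty) s
      ≤ ∑ C ∈ s, 4 * K ^ 2 * q * q ^ C.card *
          ∑ D ∈ s, q ^ (vertsOf J D \ vertsOf J C).card :=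
        Finset.sum_le_sum fun C hC => h.sq_add_sum_inter_le hs𝒞 hK hq hP hC
    _ ≤ ∑ C ∈ s, 4 * K ^ 2 * q * q ^ C.card * (L + 1) ^ (L + 1) := by
        gcongr with C hC
        exact h.sum_pow_card_vertsOf_sdiff_le hs hVq (hcard C hC)
    _ = 4 * K ^ 2 * q * (L + 1) ^ (L + 1) * ∑ C ∈ s, q ^ C.card := by
        rw [Finset.mul_sum]
        exact Finset.sum_congr rfl fun C _ => mul_right_comm _ _ _
    _ ≤ 4 * K ^ 2 * q * (L + 1) ^ (L + 1) * (L + 1) := by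
        gcongr
        exact h.sum_pow_card_le hs hVq
    _ = 4 * K ^ 2 * (L + 1) ^ (L + 2) * q := by ring

end DependenceError

end IsCycleFamily

end Counting

/-! ### The point process of the light cycles -/

theorem indepFun_pi_of_dependsOn {ι Y Z : Type*} [Fintype ι] [MeasurableSpace Y]
    [MeasurableSpace Z] {X : ι → Type*} [∀ i, MeasurableSpace (X i)] {μ : ∀ i, Measure (X i)}
    [∀ i, IsProbabilityMeasure (μ i)] {S T : Finset ι} (hST : Disjoint S T)
    {f : (∀ i, X i) → Y} {g : (∀ i, X i) → Z} (hf : Measurable f) (hg : Measurable g)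
    (hfS : DependsOn f S) (hgT : DependsOn g T) : IndepFun f g (Measure.pi μ) := by
  classical
  obtain ⟨x₀⟩ := nonempty_of_isProbabilityMeasure (Measure.pi μ)
  have hcoord : iIndepFun (fun i (x : ∀ i, X i) => x i) (Measure.pi μ) :=
    iIndepFun_pi fun _ => aemeasurable_id
  have hind := (hcoord.indepFun_finset S T hST fun i => measurable_pi_apply i).comp
    (hf.comp measurable_updateFinset) (hg.comp measurable_updateFinset)
    (φ := f ∘ Function.updateFinset x₀ S) (ψ := g ∘ Function.updateFinset x₀ T)
  have hupdate (U : Finset ι) (x : ∀ i, X i) (i : ι) (hi : i ∈ (U : Set ι)) :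
      Function.updateFinset x₀ U (fun j : U => x j) i = x i := by
    rw [Function.updateFinset, dif_pos (Finset.mem_coe.1 hi)]
  exact hind.congr (.of_forall fun x => hfS (hupdate S x)) (.of_forall fun x => hgT (hupdate T x))

section LightCycles

variable {E : Type*}

theorem dependsOn_meanWeight (C : Finset E) : DependsOn (fun w : E → ℝ => meanWeight w C) C :=
  fun _ _ h => congrArg (· / (C.card : ℝ)) (Finset.sum_congr rfl fun e he => h e he)

/-- The contribution of the cycle `C` to the process of the `c₀`-light cycles. -/
noncomputable def lightPoint (n : ℕ) (c₀ : ℝ) (C : Finset E) :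
    (E → ℝ) → Measure (Finset E × ℝ) :=
  optPoint {w | IsLight n w c₀ C} fun w => (C, (n : ℝ) * meanWeight w C)

theorem measurable_prodMk_meanWeight (n : ℕ) (C : Finset E) :
    Measurable fun w : E → ℝ => (C, (n : ℝ) * meanWeight w C) :=
  measurable_const.prodMk ((measurable_meanWeight C).const_mul _)

theorem measurable_lightPoint (n : ℕ) (c₀ : ℝ) (C : Finset E) :
    Measurable (lightPoint n c₀ C) :=
  measurable_optPoint (measurableSet_isLight n c₀ C) (measurable_prodMk_meanWeight n C)

theorem dependsOn_lightPoint (n : ℕ) (c₀ : ℝ) (C : Finset E) : DependsOn (lightPoint n c₀ C) C := by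
  intro w w' h
  have hmean : meanWeight w C = meanWeight w' C := dependsOn_meanWeight C h
  simp only [lightPoint, optPoint, Set.mem_ofPred_eq, IsLight, hmean]
  congr

variable [Fintype E]

theorem indepFun_sum_lightPoint [DecidableEq E] (n : ℕ) (c₀ : ℝ) (C : Finset E)
    (T : Finset (Finset E)) (hT : ∀ D ∈ T, ¬ (C ∩ D).Nonempty) :
    IndepFun (fun w => ∑ D ∈ T, lightPoint n c₀ D w) (lightPoint n c₀ C) (weightLaw E) := by
  refine indepFun_pi_of_dependsOn (S := T.biUnion id) (T := C) ?_
    (Finset.measurable_sum _ fun D _ => measurable_lightPoint n c₀ D)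
    (measurable_lightPoint n c₀ C) (fun w w' h => ?_) (dependsOn_lightPoint n c₀ C)
  · rw [Finset.disjoint_biUnion_left]
    exact fun D hD => (Finset.disjoint_iff_inter_eq_empty.2
      (Finset.not_nonempty_iff_eq_empty.1 (hT D hD))).symm
  · exact Finset.sum_congr rfl fun D hD => dependsOn_lightPoint n c₀ D fun e he =>
      h e (Finset.mem_coe.2 (Finset.mem_biUnion.2 ⟨D, hD, he⟩))

open Classical in
/-- The cycles of length at most `L₀`. -/
noncomputable def shortCycles (𝒞 : Set (Finset E)) (n : ℕ) : Finset (Finset E) :=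
  {C | C ∈ 𝒞 ∧ (C.card : ℝ) ≤ shortLength n}

theorem mem_shortCycles {𝒞 : Set (Finset E)} {n : ℕ} {C : Finset E} :
    C ∈ shortCycles 𝒞 n ↔ C ∈ 𝒞 ∧ (C.card : ℝ) ≤ shortLength n := by
  simp only [shortCycles, Finset.mem_filter, Finset.mem_univ, true_and]

theorem lightCycles_eq_sum (𝒞 : Set (Finset E)) (n : ℕ) (c₀ : ℝ) :
    lightCycles 𝒞 n c₀ = fun w => ∑ C ∈ shortCycles 𝒞 n, lightPoint n c₀ C w := by
  classical
  funext w
  simp only [lightCycles, lightPoint, optPoint, shortCycles, Set.mem_ofPred_eq, ← and_assoc]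
  rw [← Finset.filter_filter, Finset.sum_filter]

theorem lightIntensity_eq_sum (𝒞 : Set (Finset E)) (n : ℕ) (c₀ : ℝ) :
    lightIntensity 𝒞 n c₀ = ∑ C ∈ shortCycles 𝒞 n,
      pointIntensity (weightLaw E) {w | IsLight n w c₀ C}
        fun w => (C, (n : ℝ) * meanWeight w C) := by
  ext B hB
  have hmeas (C : Finset E) : Measurable fun w => lightPoint n c₀ C w B :=
    (Measure.measurable_coe hB).comp (measurable_lightPoint n c₀ C)
  simp only [lightIntensity_apply 𝒞 n c₀ hB, lightCycles_eq_sum, Measure.coe_finsetSum,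
    Finset.sum_apply]
  rw [lintegral_finsetSum _ fun C _ => hmeas C]
  exact Finset.sum_congr rfl fun C _ => lintegral_optPoint _ (measurableSet_isLight n c₀ C)
    (measurable_prodMk_meanWeight n C) hB

instance isFiniteMeasure_lightIntensity (𝒞 : Set (Finset E)) (n : ℕ) (c₀ : ℝ) :
    IsFiniteMeasure (lightIntensity 𝒞 n c₀) := by
  rw [lightIntensity_eq_sum]
  infer_instance

theorem leUpTo_lightCycles_dependenceError [DecidableEq E] (𝒞 : Set (Finset E)) (n : ℕ) (c₀ : ℝ) :
    LeUpTo ((weightLaw E).map (lightCycles 𝒞 n c₀)) (poissonLaw (lightIntensity 𝒞 n c₀))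
      (dependenceError (weightLaw E) (fun C => {w | IsLight n w c₀ C})
        (fun C D => (C ∩ D).Nonempty) (shortCycles 𝒞 n)) := by
  rw [lightCycles_eq_sum, lightIntensity_eq_sum]
  exact leUpTo_sum_optPoint _ (measurableSet_isLight n c₀) (measurable_prodMk_meanWeight n) _
    (indepFun_sum_lightPoint n c₀) _

end LightCycles

/-! ### The error of the Poisson approximation -/

/-- The bound for the total variation distance of the light cycles and the Poisson process with
the same intensity: the expected number of pairs of overlapping short light cycles is of at most
this order. -/
noncomputable def poissonError (c₀ : ℝ) (n : ℕ) : ℝ :=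
  4 * Real.exp (4 * |c₀| * ⌊shortLength n⌋₊) *
    (⌊shortLength n⌋₊ + 1) ^ (⌊shortLength n⌋₊ + 2) * (n : ℝ)⁻¹

theorem ofReal_poissonError (c₀ : ℝ) (n : ℕ) :
    ENNReal.ofReal (poissonError c₀ n) =
      4 * ENNReal.ofReal (Real.exp (2 * |c₀| * ⌊shortLength n⌋₊)) ^ 2 *
        (⌊shortLength n⌋₊ + 1) ^ (⌊shortLength n⌋₊ + 2) * ENNReal.ofReal (n : ℝ)⁻¹ := by
  have hsucc : (⌊shortLength n⌋₊ + 1 : ℝ≥0∞) = ENNReal.ofReal (⌊shortLength n⌋₊ + 1) := by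
    rw [ENNReal.ofReal_add (Nat.cast_nonneg _) zero_le_one, ENNReal.ofReal_natCast,
      ENNReal.ofReal_one]
  have hexp : Real.exp (4 * |c₀| * ⌊shortLength n⌋₊) =
      Real.exp (2 * |c₀| * ⌊shortLength n⌋₊) ^ 2 := by
    rw [← Real.exp_nat_mul]
    ring_nf
  rw [poissonError, hexp, ENNReal.ofReal_mul (by positivity), ENNReal.ofReal_mul (by positivity),
    ENNReal.ofReal_mul (by positivity), ENNReal.ofReal_pow (by positivity),
    ENNReal.ofReal_pow (by positivity), ENNReal.ofReal_ofNat, hsucc]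

theorem weightLaw_isLight_inter_le_of_card_le {E : Type*} [Fintype E] [DecidableEq E] {n : ℕ}
    (hn : 0 < n) (c : ℝ) {C D : Finset E} (hC : C.Nonempty) (hD : D.Nonempty) {L : ℕ}
    (hCL : C.card ≤ L) (hDL : D.card ≤ L) :
    weightLaw E ({w | IsLight n w c C} ∩ {w | IsLight n w c D}) ≤
      ENNReal.ofReal (Real.exp (2 * |c| * L)) * ENNReal.ofReal (n : ℝ)⁻¹ ^ (C ∪ D).card := by
  have hexponent : c * (C.card + D.card) ≤ 2 * |c| * L := by
    calc c * (C.card + D.card) ≤ |c| * (L + L) := by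
          gcongr
          exact le_abs_self c
      _ = 2 * |c| * L := by ring
  refine (weightLaw_isLight_inter_le hn c hC hD).trans ?_
  gcongr

theorem IsCycleFamily.leUpTo_lightCycles {V E : Type*} [Fintype V] [Fintype E]
    {J : V → V → E → Prop} {𝒞 : Set (Finset E)} (h : IsCycleFamily J 𝒞) {n : ℕ} (hn : 0 < n)
    (hV : Fintype.card V ≤ n) (c₀ : ℝ) :
    LeUpTo ((weightLaw E).map (lightCycles 𝒞 n c₀)) (poissonLaw (lightIntensity 𝒞 n c₀))
      (ENNReal.ofReal (poissonError c₀ n)) := by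
  classical
  have hn' : (0 : ℝ) < n := Nat.cast_pos.2 hn
  have hs : ∀ C ∈ shortCycles 𝒞 n, C ∈ 𝒞 ∧ C.card ≤ ⌊shortLength n⌋₊ := fun C hC =>
    (mem_shortCycles.1 hC).imp_right Nat.le_floor
  have hK : 1 ≤ ENNReal.ofReal (Real.exp (2 * |c₀| * ⌊shortLength n⌋₊)) := by
    rw [ENNReal.one_le_ofReal, Real.one_le_exp_iff]
    positivity
  have hq : ENNReal.ofReal (n : ℝ)⁻¹ ≤ 1 :=
    ENNReal.ofReal_le_one.2 (inv_le_one_of_one_le₀ (Nat.one_le_cast.2 hn))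
  have hVq : (Fintype.card V : ℝ≥0∞) * ENNReal.ofReal (n : ℝ)⁻¹ ≤ 1 := by
    calc (Fintype.card V : ℝ≥0∞) * ENNReal.ofReal (n : ℝ)⁻¹ ≤ n * ENNReal.ofReal (n : ℝ)⁻¹ := by
          gcongr
      _ = 1 := by
          rw [← ENNReal.ofReal_natCast, ← ENNReal.ofReal_mul hn'.le, mul_inv_cancel₀ hn'.ne',
            ENNReal.ofReal_one]
  refine (leUpTo_lightCycles_dependenceError 𝒞 n c₀).mono ?_
  rw [ofReal_poissonError]
  exact h.dependenceError_le hs hK hq hVq fun C hC D hD =>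
    weightLaw_isLight_inter_le_of_card_le hn c₀ (h.nonempty (hs C hC).1)
      (h.nonempty (hs D hD).1) (hs C hC).2 (hs D hD).2

theorem tendsto_log_natCast_atTop : Tendsto (fun n : ℕ => Real.log n) atTop atTop :=
  Real.tendsto_log_atTop.comp tendsto_natCast_atTop_atTop

theorem eventually_floor_shortLength_mul_log_log_le :
    ∀ᶠ n : ℕ in atTop, ⌊shortLength n⌋₊ * Real.log (Real.log n) ≤ Real.log n / 2 := by
  filter_upwards [tendsto_log_natCast_atTop.eventually_ge_atTop 0,
    (Real.tendsto_log_atTop.comp tendsto_log_natCast_atTop).eventually_gt_atTop 0] with n hx hy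
  have hy₂ : 0 < 2 * Real.log (Real.log n) := mul_pos two_pos hy
  have hL : (⌊shortLength n⌋₊ : ℝ) ≤ Real.log n / (2 * Real.log (Real.log n)) :=
    Nat.floor_le (div_nonneg hx hy₂.le)
  rw [le_div_iff₀ hy₂] at hL
  linarith

theorem eventually_poissonError_le (c₀ : ℝ) : ∀ᶠ n : ℕ in atTop,
    poissonError c₀ n ≤ 4 * (Real.log n ^ 2 * Real.exp (-(3 / 8) * Real.log n)) := by
  filter_upwards [eventually_floor_shortLength_mul_log_log_le,
    tendsto_log_natCast_atTop.eventually_gt_atTop 0,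
    (Real.tendsto_log_atTop.comp tendsto_log_natCast_atTop).eventually_ge_atTop (max 1 (16 * |c₀|)),
    eventually_gt_atTop 0] with n hLlog hx hy hn
  obtain ⟨hy1, hyc⟩ := max_le_iff.1 hy
  rw [poissonError]
  simp only [Function.comp_apply] at hy1 hyc ⊢
  have hn' : (n : ℝ)⁻¹ = Real.exp (-Real.log n) := by
    rw [Real.exp_neg, Real.exp_log (Nat.cast_pos.2 hn)]
  rw [hn']
  set L := ⌊shortLength n⌋₊
  set x := Real.log n
  have hx2 : Real.log x + 1 ≤ x := by linarith [Real.log_le_sub_one_of_pos hx]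
  have hL1 : (L + 1 : ℝ) ≤ x := by
    nlinarith [mul_le_mul_of_nonneg_left hy1 (Nat.cast_nonneg (α := ℝ) L)]
  have hpow : (L + 1 : ℝ) ^ L ≤ Real.exp (x / 2) := by
    calc (L + 1 : ℝ) ^ L ≤ x ^ L := by gcongr
      _ = Real.exp (L * Real.log x) := by rw [Real.exp_nat_mul, Real.exp_log hx]
      _ ≤ Real.exp (x / 2) := Real.exp_le_exp.2 hLlog
  have hexp : Real.exp (4 * |c₀| * L) ≤ Real.exp (x / 8) := by
    refine Real.exp_le_exp.2 ?_
    nlinarith [mul_le_mul_of_nonneg_right hyc (Nat.cast_nonneg (α := ℝ) L)]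
  calc 4 * Real.exp (4 * |c₀| * L) * (L + 1 : ℝ) ^ (L + 2) * Real.exp (-x)
      = 4 * (Real.exp (4 * |c₀| * L) * ((L + 1 : ℝ) ^ L * (L + 1) ^ 2) * Real.exp (-x)) := by
        ring
    _ ≤ 4 * (Real.exp (x / 8) * (Real.exp (x / 2) * x ^ 2) * Real.exp (-x)) := by gcongr
    _ = 4 * (x ^ 2 * Real.exp (x / 8 + x / 2 + -x)) := by
        rw [Real.exp_add, Real.exp_add]
        ring
    _ = 4 * (x ^ 2 * Real.exp (-(3 / 8) * x)) := by
        ring_nf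

theorem tendsto_poissonError (c₀ : ℝ) : Tendsto (poissonError c₀) atTop (nhds 0) := by
  have hbound : Tendsto (fun x : ℝ => 4 * (x ^ 2 * Real.exp (-(3 / 8) * x))) atTop (nhds 0) := by
    simpa only [mul_zero, Real.rpow_ofNat] using
      (tendsto_rpow_mul_exp_neg_mul_atTop_nhds_zero 2 (3 / 8) (by norm_num)).const_mul 4
  refine squeeze_zero' (.of_forall fun n => ?_) (eventually_poissonError_le c₀)
    (hbound.comp tendsto_log_natCast_atTop)
  unfold poissonError
  positivity

instance (E : Type*) [Fintype E] (𝒞 : Set (Finset E)) (n : ℕ) (c₀ : ℝ) :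
    IsProbabilityMeasure ((weightLaw E).map (lightCycles 𝒞 n c₀)) :=
  Measure.isProbabilityMeasure_map (measurable_lightCycles 𝒞 n c₀).aemeasurable

theorem eventually_leUpTo_lightCycles {V E : ℕ → Type*} [∀ n, Fintype (V n)] [∀ n, Fintype (E n)]
    {J : ∀ n, V n → V n → E n → Prop} {𝒞 : ∀ n, Set (Finset (E n))}
    (h : ∀ n, IsCycleFamily (J n) (𝒞 n)) (hV : ∀ n, Fintype.card (V n) ≤ n) (c₀ : ℝ) {ε : ℝ}
    (hε : 0 < ε) :
    ∀ᶠ n : ℕ in atTop, LeUpTo ((weightLaw (E n)).map (lightCycles (𝒞 n) n c₀))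
      (poissonLaw (lightIntensity (𝒞 n) n c₀)) (ENNReal.ofReal ε) := by
  filter_upwards [(tendsto_poissonError c₀).eventually_le_const hε, eventually_gt_atTop 0]
    with n herr hn
  exact ((h n).leUpTo_lightCycles hn (hV n) c₀).mono (ENNReal.ofReal_le_ofReal herr)

/-! ### Coupling with a Poisson process -/

theorem ncard_isLight_eq {E : Type*} [Fintype E] (𝒞 : Set (Finset E)) {n : ℕ} (hn : 0 < n)
    (w : E → ℝ) {k : ℕ} (hk : (k : ℝ) ≤ shortLength n) {c c₀ : ℝ} (hc : c ≤ c₀) :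
    ({C ∈ 𝒞 | C.card = k ∧ IsLight n w c C}.ncard : ℝ≥0∞) =
      lightCycles 𝒞 n c₀ w ({C ∈ 𝒞 | C.card = k} ×ˢ Set.Iic c) := by
  classical
  have hB : MeasurableSet ({C ∈ 𝒞 | C.card = k} ×ˢ Set.Iic c) :=
    (Set.toFinite _).measurableSet.prod measurableSet_Iic
  have hlight (C : Finset E) : (n : ℝ) * meanWeight w C ≤ c ↔ IsLight n w c C := by
    rw [IsLight, le_div_iff₀ (Nat.cast_pos.2 hn), mul_comm]
  have hmono (C : Finset E) (h : IsLight n w c C) : IsLight n w c₀ C := h.trans (by gcongr)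
  rw [lightCycles, Measure.coe_finsetSum, Finset.sum_apply]
  simp only [Measure.dirac_apply' _ hB, Set.indicator_apply, Pi.one_apply, Set.mem_prod,
    Set.mem_Iic, hlight, Set.mem_ofPred_eq]
  rw [Finset.sum_boole, Finset.filter_filter, ← Set.ncard_coe_finset]
  congr 2
  ext C
  simp only [Set.mem_ofPred_eq, Finset.coe_filter, Finset.mem_univ, true_and]
  constructor
  · rintro ⟨hC, hCk, hCc⟩
    exact ⟨⟨hC, by rwa [hCk], hmono C hCc⟩, ⟨hC, hCk⟩, hCc⟩
  · rintro ⟨-, ⟨hC, hCk⟩, hCc⟩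
    exact ⟨hC, hCk, hCc⟩

universe u in
theorem exists_coupling_lightCycles {E : Type u} [Fintype E] (𝒞 : Set (Finset E)) {n : ℕ}
    (hn : 0 < n) {c₀ : ℝ} {Q : Measure (Measure (Finset E × ℝ))}
    (hQ : IsPoissonProcessLaw (lightIntensity 𝒞 n c₀) Q) {δ : ℝ≥0∞}
    (h : LeUpTo ((weightLaw E).map (lightCycles 𝒞 n c₀)) Q δ) :
    ∃ (Ω : Type u) (_ : MeasurableSpace Ω) (P : Measure Ω) (W : Ω → E → ℝ)
      (η : Ω → Measure (Finset E × ℝ)),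
      IsProbabilityMeasure P ∧ Measurable W ∧ Measurable η ∧ P.map W = weightLaw E ∧
      IsPoissonProcessLaw (lightIntensity 𝒞 n c₀) (P.map η) ∧
      P {ω | ¬ ∀ k : ℕ, (k : ℝ) ≤ shortLength n → ∀ c : ℝ, c ≤ c₀ →
          (({C ∈ 𝒞 | C.card = k ∧ IsLight n (W ω) c C}.ncard : ℕ) : ℝ≥0∞) =
            η ω ({C ∈ 𝒞 | C.card = k} ×ˢ Set.Iic c)} ≤ δ := by
  have := hQ.isProbabilityMeasure
  obtain ⟨Ω, _, P, W, η, hW, hη, hPW, hPη, hne⟩ :=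
    h.exists_coupling (measurable_lightCycles 𝒞 n c₀)
  have : IsProbabilityMeasure (P.map W) := hPW ▸ inferInstance
  refine ⟨Ω, _, P, W, η, Measure.isProbabilityMeasure_of_map W, hW, hη, hPW,
    hPη ▸ hQ, le_trans (measure_mono ?_) hne⟩
  refine fun ω hω heq => hω fun k hk c hc => ?_
  rw [heq, ncard_isLight_eq 𝒞 hn (W ω) hk hc]

theorem mainTheorem3 (c₀ ε : ℝ) (hε : 0 < ε) :
    -- the complete directed graph
    (∀ᶠ n : ℕ in atTop,
      (∀ Q : Measure (Measure (Finset (DirEdge (Fin n)) × ℝ)),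
        IsPoissonProcessLaw (lightIntensity (dirCycles (Fin n)) n c₀) Q →
          tvDist ((weightLaw (DirEdge (Fin n))).map (lightCycles (dirCycles (Fin n)) n c₀)) Q
            ≤ ε) ∧
      ∃ (Ω : Type) (_ : MeasurableSpace Ω) (P : Measure Ω) (W : Ω → DirEdge (Fin n) → ℝ)
        (η : Ω → Measure (Finset (DirEdge (Fin n)) × ℝ)),
        IsProbabilityMeasure P ∧ Measurable W ∧ Measurable η ∧
        P.map W = weightLaw (DirEdge (Fin n)) ∧
        IsPoissonProcessLaw (lightIntensity (dirCycles (Fin n)) n c₀) (P.map η) ∧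
        P {ω | ¬ ∀ k : ℕ, (k : ℝ) ≤ shortLength n → ∀ c : ℝ, c ≤ c₀ →
            (({C ∈ dirCycles (Fin n) | C.card = k ∧ IsLight n (W ω) c C}.ncard : ℕ) : ℝ≥0∞) =
              η ω ({C ∈ dirCycles (Fin n) | C.card = k} ×ˢ Set.Iic c)}
          ≤ ENNReal.ofReal ε) ∧
    -- the complete undirected graph
    (∀ᶠ n : ℕ in atTop,
      (∀ Q : Measure (Measure (Finset (UndirEdge (Fin n)) × ℝ)),
        IsPoissonProcessLaw (lightIntensity (undirCycles (Fin n)) n c₀) Q →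
          tvDist ((weightLaw (UndirEdge (Fin n))).map (lightCycles (undirCycles (Fin n)) n c₀)) Q
            ≤ ε) ∧
      ∃ (Ω : Type) (_ : MeasurableSpace Ω) (P : Measure Ω) (W : Ω → UndirEdge (Fin n) → ℝ)
        (η : Ω → Measure (Finset (UndirEdge (Fin n)) × ℝ)),
        IsProbabilityMeasure P ∧ Measurable W ∧ Measurable η ∧
        P.map W = weightLaw (UndirEdge (Fin n)) ∧
        IsPoissonProcessLaw (lightIntensity (undirCycles (Fin n)) n c₀) (P.map η) ∧
        P {ω | ¬ ∀ k : ℕ, (k : ℝ) ≤ shortLength n → ∀ c : ℝ, c ≤ c₀ →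
            (({C ∈ undirCycles (Fin n) | C.card = k ∧ IsLight n (W ω) c C}.ncard : ℕ) : ℝ≥0∞) =
              η ω ({C ∈ undirCycles (Fin n) | C.card = k} ×ˢ Set.Iic c)}
          ≤ ENNReal.ofReal ε) := by
  have hdir := eventually_leUpTo_lightCycles (fun n => isCycleFamily_dirCycles (Fin n))
    (fun n => (Fintype.card_fin n).le) c₀ hε
  have hundir := eventually_leUpTo_lightCycles (fun n => isCycleFamily_undirCycles (Fin n))
    (fun n => (Fintype.card_fin n).le) c₀ hε
  constructor
  · filter_upwards [hdir, eventually_gt_atTop 0] with n h hn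
    have hΛ := isPoissonProcessLaw_poissonLaw (lightIntensity (dirCycles (Fin n)) n c₀)
    exact ⟨fun Q hQ => hQ.unique hΛ ▸ h.tvDist_le hε.le, exists_coupling_lightCycles _ hn hΛ h⟩
  · filter_upwards [hundir, eventually_gt_atTop 0] with n h hn
    have hΛ := isPoissonProcessLaw_poissonLaw (lightIntensity (undirCycles (Fin n)) n c₀)
    exact ⟨fun Q hQ => hQ.unique hΛ ▸ h.tvDist_le hε.le, exists_coupling_lightCycles _ hn hΛ h⟩
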